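/- Let $n\ge 1$ and $p\ge 0$ be integers, let $P\in\mathbb C[x_1,\dots,x_n]$ be a homogeneous polynomial of degree $p$ (the zero polynomial is allowed), and let $\|k\|^2=\sum_{i=1}^n k_i^2$. For $a\in\mathbb R^n$ put $$f_a(s)=\sum_{0\ne k\in\mathbb Z^n}\frac{P(k)}{\|k\|^{s}}\,e^{2\pi i\,k\cdot a},\qquad \operatorname{Re}s>n+p ,$$ where the series converges absolutely. Let $dS$ be the surface measure of the unit sphere $S^{n-1}\subset\mathbb R^n$ (counting measure if $n=1$). Then: (i) If $a\in\mathbb Z^n$, then $f_a$ extends meromorphically to $\mathbb C$, with $$\operatorname*{Res}_{s=n+p}f_a(s)=\int_{S^{n-1}}P(u)\,dS(u),$$ and $f_a$ fails to extend to an entire function if and only if this number is nonzero. (ii) If $a\in\mathbb R^n\setminus\mathbb Z^n$, then $f_a$ extends to an entire function. (iii) Call $v\in\mathbb R^n$ badly approximable if there are $\delta>0$ and $c_0>0$ with $|k\cdot v-m|\ge c_0\|k\|^{-\delta}$ for all $k\in\mathbb Z^n\setminus\{0\}$ and $m\in\mathbb Z$, and call a real $n\times n$ matrix $\Theta$ badly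 approximable if ${}^t\Theta u$ is badly approximable for some $u\in\mathbb Z^n$. Let $\Theta$ be badly approximable, $q\ge 1$ an integer, $\epsilon_1,\dots,\epsilon_q\in\{1,0,-1\}$, and let $c:(\mathbb Z^n)^q\to\mathbb C$ be a Schwartz function, that is, $\sup_l(1+|l|)^N|c(l)|<\infty$ for every $N\in\mathbb N$. Then $c$ is summable, the series $$g(s)=\sum_{l\in(\mathbb Z^n)^q}c(l)\,f_{\Theta(\sum_i\epsilon_i l_i)}(s)$$ converges absolutely for $\operatorname{Re}s>n+p$, and $g$ extends to a meromorphic function on $\mathbb C$ that is holomorphic away from $s=n+p$ and has at most a simple pole at $s=n+p$, with residue $$\operatorname*{Res}_{s=n+p}g(s)=\Big(\sum_{l\in Z}c(l)\Big)\int_{S^{n-1}}P(u)\,dS(u),\qquad Z=\Big\{l\in(\mathbb Z^n)^q:\ \sum_{i=1}^q\epsilon_i l_i=0\Big\}.$$ -/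

import Mathlib

noncomputable section

namespace EpsteinZeta

/-- The Euclidean norm of an integer vector. -/
def euclNorm {n : ℕ} (k : Fin n → ℤ) : ℝ :=
  Real.sqrt (∑ i, (k i : ℝ) ^ 2)

/-- The inner product `k · a` of an integer vector and a real vector. -/
def pair {n : ℕ} (k : Fin n → ℤ) (a : Fin n → ℝ) : ℝ :=
  ∑ i, (k i : ℝ) * a i

/-- The summand `P(k) ‖k‖^(-s) exp(2π i k·a)`. -/
def term {n : ℕ} (P : MvPolynomial (Fin n) ℂ) (a : Fin n → ℝ) (s : ℂ) (k : Fin n → ℤ) : ℂ :=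
  MvPolynomial.eval (fun i => (k i : ℂ)) P / (euclNorm k : ℂ) ^ s *
    Complex.exp (2 * Real.pi * Complex.I * (pair k a : ℂ))

/-- The series `f_a(s) = ∑_{0 ≠ k ∈ ℤⁿ} P(k) ‖k‖^(-s) exp(2π i k·a)`. -/
def f {n : ℕ} (P : MvPolynomial (Fin n) ℂ) (a : Fin n → ℝ) (s : ℂ) : ℂ :=
  ∑' k : {k : Fin n → ℤ // k ≠ 0}, term P a s k.1

/-- `a` is an integer vector. -/
def IsIntegerVector {n : ℕ} (a : Fin n → ℝ) : Prop :=
  ∃ m : Fin n → ℤ, ∀ i, a i = (m i : ℝ)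

/-- The integral of `P` over the unit sphere of `ℝⁿ` with respect to the surface measure. -/
def sphereIntegral {n : ℕ} (P : MvPolynomial (Fin n) ℂ) : ℂ :=
  ∫ u : Metric.sphere (0 : EuclideanSpace ℝ (Fin n)) 1,
    MvPolynomial.eval (fun i => (((u : EuclideanSpace ℝ (Fin n)) i : ℝ) : ℂ)) P
      ∂((MeasureTheory.volume : MeasureTheory.Measure (EuclideanSpace ℝ (Fin n))).toSphere)

/-- `F` and `h` agree on the half-plane `Re s > σ`. -/
def AgreeOnHalfPlane (σ : ℝ) (h F : ℂ → ℂ) : Prop :=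
  ∀ s : ℂ, σ < s.re → F s = h s

/-- `h`, given on the half-plane `Re s > σ`, extends to an entire function. -/
def HasEntireExtension (σ : ℝ) (h : ℂ → ℂ) : Prop :=
  ∃ E : ℂ → ℂ, Differentiable ℂ E ∧ AgreeOnHalfPlane σ h E

/-- The residue at `z₀` of `F`, meromorphic there, is `r`: for every small enough radius `ρ > 0`,
the integral of `F` over the circle of radius `ρ` about `z₀` is `2π i r`. -/
def HasResidueAt (F : ℂ → ℂ) (z₀ r : ℂ) : Prop :=
  MeromorphicAt F z₀ ∧
    ∃ ρ₀ > (0 : ℝ), ∀ ρ : ℝ, 0 < ρ → ρ < ρ₀ →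
      (∮ z in C(z₀, ρ), F z) = 2 * Real.pi * Complex.I * r

/-- `a` is `δ`-badly approximable: `|q·a - m| ≥ c |q|^(-δ)` for some `c > 0` and all integer
vectors `q ≠ 0` and integers `m`. -/
def BadlyApproximableWith {n : ℕ} (δ : ℝ) (a : Fin n → ℝ) : Prop :=
  ∃ c > (0 : ℝ), ∀ q : Fin n → ℤ, q ≠ 0 → ∀ m : ℤ,
    c * euclNorm q ^ (-δ) ≤ |pair q a - (m : ℝ)|

/-- `a` is badly approximable. -/
def BadlyApproximable {n : ℕ} (a : Fin n → ℝ) : Prop :=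
  ∃ δ > (0 : ℝ), BadlyApproximableWith δ a

/-- The matrix `Θ` is badly approximable: `ᵗΘ u` is badly approximable for some `u ∈ ℤⁿ`. -/
def BadlyApproximableMatrix {n : ℕ} (Θ : Matrix (Fin n) (Fin n) ℝ) : Prop :=
  ∃ u : Fin n → ℤ, BadlyApproximable (Θ.transpose.mulVec (fun i => (u i : ℝ)))

/-- The Schwartz space of `(ℤⁿ)^q`: functions decaying faster than every power of the norm. -/
def IsSchwartz {q n : ℕ} (c : (Fin q → Fin n → ℤ) → ℂ) : Prop :=
  ∀ N : ℕ, ∃ C : ℝ, ∀ l : Fin q → Fin n → ℤ, (1 + ‖l‖) ^ N * ‖c l‖ ≤ C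

/-- The integer vector `∑ εᵢ lᵢ`. -/
def combo {q n : ℕ} (ε : Fin q → ℤ) (l : Fin q → Fin n → ℤ) : Fin n → ℤ :=
  ∑ i, ε i • l i

/-- The real vector `Θ m`, for an integer vector `m`. -/
def apply {n : ℕ} (Θ : Matrix (Fin n) (Fin n) ℝ) (m : Fin n → ℤ) : Fin n → ℝ :=
  Θ.mulVec (fun i => (m i : ℝ))

/-- The series `g(s) = ∑_l c(l) f_{Θ(∑ εᵢ lᵢ)}(s)`. -/
def g {q n : ℕ} (P : MvPolynomial (Fin n) ℂ) (Θ : Matrix (Fin n) (Fin n) ℝ) (ε : Fin q → ℤ)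
    (c : (Fin q → Fin n → ℤ) → ℂ) (s : ℂ) : ℂ :=
  ∑' l : Fin q → Fin n → ℤ, c l * f P (apply Θ (combo ε l)) s

end EpsteinZeta

end

noncomputable section

namespace EpsteinZeta

section

open MvPolynomial Finset

/-- The Euclidean space of dimension `n`. -/
abbrev V (n : ℕ) := EuclideanSpace ℝ (Fin n)

/-- The value of a complex polynomial at a real point. -/
def evalReal {n : ℕ} (Q : MvPolynomial (Fin n) ℂ) (x : V n) : ℂ :=
  MvPolynomial.eval (fun i => ((x i : ℝ) : ℂ)) Q

/-- The function `Q(x) ‖x‖^(-(s + 2m))`. -/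
def gen {n : ℕ} (Q : MvPolynomial (Fin n) ℂ) (m : ℕ) (s : ℂ) (x : V n) : ℂ :=
  evalReal Q x * Complex.exp (-(s + 2 * m) * (Real.log ‖x‖ : ℂ))

/-- Families of functions `φ s`, homogeneous of degree `d - s` away from the origin: combinations
of the functions `gen Q m s` with coefficients entire in `s`. -/
inductive Symb {n : ℕ} : ℤ → (ℂ → V n → ℂ) → Prop
  | gen {d : ℤ} (Q : MvPolynomial (Fin n) ℂ) (q m : ℕ) (hQ : Q.IsHomogeneous q)
      (hd : d = (q : ℤ) - 2 * m) : Symb d (gen Q m)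
  | add {d : ℤ} {φ ψ : ℂ → V n → ℂ} : Symb d φ → Symb d ψ → Symb d (fun s x => φ s x + ψ s x)
  | smul {d : ℤ} {φ : ℂ → V n → ℂ} (c : ℂ → ℂ) (hc : Differentiable ℂ c) :
      Symb d φ → Symb d (fun s x => c s * φ s x)
  | congr {d : ℤ} {φ ψ : ℂ → V n → ℂ} :
      Symb d φ → (∀ s x, x ≠ 0 → φ s x = ψ s x) → Symb d ψ

/-- The derivative of a family of functions in the direction `u`. -/
def dirDeriv {n : ℕ} (u : V n) (φ : ℂ → V n → ℂ) (s : ℂ) (x : V n) : ℂ :=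
  deriv (fun t : ℝ => φ s (x + t • u)) 0

/-- The `i`-th partial derivative of `gen Q m`. -/
def genPartial {n : ℕ} (Q : MvPolynomial (Fin n) ℂ) (m : ℕ) (i : Fin n) (s : ℂ) (x : V n) : ℂ :=
  gen (pderiv i Q) m s x + (-(s + 2 * m)) * gen (X i * Q) (m + 1) s x

lemma hasDerivAt_evalReal {n : ℕ} (Q : MvPolynomial (Fin n) ℂ) (x u : V n) :
    HasDerivAt (fun t : ℝ => evalReal Q (x + t • u))
      (∑ i, (u i : ℂ) * evalReal (pderiv i Q) x) 0 := by
  induction Q using MvPolynomial.induction_on with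
  | C a => simpa [evalReal] using hasDerivAt_const (0 : ℝ) a
  | add p q hp hq =>
    simpa [evalReal, mul_add, sum_add_distrib] using hp.fun_add hq
  | mul_X p j hp =>
    have h1 : HasDerivAt (fun t : ℝ => (((x + t • u) j : ℝ) : ℂ)) (u j : ℂ) 0 := by
      have : HasDerivAt (fun t : ℝ => x j + t * u j) (u j) 0 := by
        simpa using ((hasDerivAt_id (0 : ℝ)).mul_const (u j)).const_add (x j)
      simpa using this.ofReal_comp
    have h2 := hp.mul h1
    have e : (fun t : ℝ => evalReal (p * X j) (x + t • u)) =
        (fun t : ℝ => evalReal p (x + t • u)) * fun t : ℝ => (((x + t • u) j : ℝ) : ℂ) := by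
      ext t; simp [evalReal]
    rw [e]
    refine h2.congr_deriv ?_
    simp only [Derivation.leibniz, pderiv_X, smul_eq_mul, evalReal, map_add, map_mul, eval_X,
      mul_add, sum_add_distrib, zero_smul, add_zero, Finset.sum_mul]
    have h3 : ∑ i, (u i : ℂ) * (MvPolynomial.eval (fun i => ((x i : ℝ) : ℂ)) p *
        MvPolynomial.eval (fun i => ((x i : ℝ) : ℂ))
          (Pi.single (M := fun _ => MvPolynomial (Fin n) ℂ) i 1 j)) =
        MvPolynomial.eval (fun i => ((x i : ℝ) : ℂ)) p * (u j : ℂ) := by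
      rw [Finset.sum_eq_single j]
      · simp; ring
      · intro b _ hb
        simp [hb.symm]
      · simp
    rw [h3, add_comm]
    congr 1
    exact sum_congr rfl fun i _ => by ring

lemma hasDerivAt_log_norm {n : ℕ} {x : V n} (hx : x ≠ 0) (u : V n) :
    HasDerivAt (fun t : ℝ => Real.log ‖x + t • u‖) ((∑ i, u i * x i) / ‖x‖ ^ 2) 0 := by
  have h0 : HasDerivAt (fun t : ℝ => x + t • u) u 0 := by
    simpa using ((hasDerivAt_id (0 : ℝ)).smul_const u).const_add x
  have h1 := h0.norm_sq
  have hx' : ‖x‖ ^ 2 ≠ 0 := by simpa using hx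
  have h2 := (h1.log (by simpa using hx')).div_const 2
  have e : (fun t : ℝ => Real.log ‖x + t • u‖) =
      fun t : ℝ => Real.log (‖x + t • u‖ ^ 2) / 2 := by
    ext t; rw [Real.log_pow]; push_cast; ring
  rw [e]
  refine h2.congr_deriv ?_
  simp only [zero_smul, add_zero, PiLp.inner_apply, RCLike.inner_apply, conj_trivial]
  field_simp

lemma exp_log_norm_shift {n : ℕ} {x : V n} (hx : x ≠ 0) (m : ℕ) (s : ℂ) :
    Complex.exp (-(s + 2 * ((m + 1 : ℕ) : ℂ)) * (Real.log ‖x‖ : ℂ)) * (‖x‖ : ℂ) ^ 2 =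
      Complex.exp (-(s + 2 * m) * (Real.log ‖x‖ : ℂ)) := by
  have hx' : 0 < ‖x‖ := norm_pos_iff.2 hx
  have : (‖x‖ : ℂ) = Complex.exp (Real.log ‖x‖ : ℂ) := by
    rw [← Complex.ofReal_exp, Real.exp_log hx']
  rw [this, ← Complex.exp_nat_mul, ← Complex.exp_add]
  congr 1
  push_cast
  ring

lemma hasDerivAt_gen {n : ℕ} (Q : MvPolynomial (Fin n) ℂ) (m : ℕ) (s : ℂ) {x : V n}
    (hx : x ≠ 0) (u : V n) :
    HasDerivAt (fun t : ℝ => gen Q m s (x + t • u)) (∑ i, (u i : ℂ) * genPartial Q m i s x) 0 := by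
  have h1 := hasDerivAt_evalReal Q x u
  have h2 := (((hasDerivAt_log_norm hx u).ofReal_comp.const_mul (-(s + 2 * m))).cexp)
  have h3 := h1.mul h2
  have hx' : (‖x‖ : ℂ) ≠ 0 := by simpa using hx
  refine h3.congr_deriv ?_
  simp only [zero_smul, add_zero, genPartial, gen, mul_add, sum_add_distrib, Finset.sum_mul]
  congr 1
  · exact sum_congr rfl fun i _ => by ring
  · rw [← exp_log_norm_shift hx m s]
    push_cast
    rw [Finset.sum_div, Finset.mul_sum, Finset.mul_sum, Finset.mul_sum]
    refine sum_congr rfl fun i _ => ?_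
    simp only [evalReal, map_mul, eval_X]
    field_simp

lemma symb_zero {n : ℕ} (d : ℤ) : Symb (n := n) d (fun _ _ => 0) := by
  refine Symb.congr (φ := gen 0 (d.natAbs)) (Symb.gen 0 (d + 2 * d.natAbs).toNat d.natAbs
    (isHomogeneous_zero _ _ _) (by omega)) fun s x _ => by simp [gen, evalReal]

lemma Symb.sum {n : ℕ} {d : ℤ} {κ : Type*} (t : Finset κ) {φ : κ → ℂ → V n → ℂ}
    (h : ∀ i ∈ t, Symb d (φ i)) : Symb d (fun s x => ∑ i ∈ t, φ i s x) := by
  classical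
  induction t using Finset.induction_on with
  | empty => simpa using symb_zero d
  | insert a t ha ih =>
    simp only [Finset.sum_insert ha]
    exact (h a (by simp)).add (ih fun i hi => h i (by simp [hi]))

lemma symb_genPartial {n : ℕ} {Q : MvPolynomial (Fin n) ℂ} {q : ℕ} (hQ : Q.IsHomogeneous q)
    (m : ℕ) (i : Fin n) : Symb ((q : ℤ) - 2 * m - 1) (genPartial Q m i) := by
  refine Symb.add ?_ (Symb.smul (fun s => -(s + 2 * m)) (by fun_prop) ?_)
  · rcases Nat.eq_zero_or_pos q with rfl | hq
    · have : pderiv i Q = 0 := by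
        rw [(totalDegree_eq_zero_iff_eq_C (p := Q)).1 (Nat.le_zero.1 hQ.totalDegree_le)]
        simp
      rw [this]
      exact (symb_zero _).congr fun s x _ => by simp [EpsteinZeta.gen, evalReal]
    · exact Symb.gen _ (q - 1) m hQ.pderiv (by omega)
  · exact Symb.gen _ (1 + q) (m + 1) ((isHomogeneous_X ℂ i).mul hQ) (by push_cast; ring)

lemma dirDeriv_gen {n : ℕ} (Q : MvPolynomial (Fin n) ℂ) (m : ℕ) (u : V n) (s : ℂ) {x : V n}
    (hx : x ≠ 0) : dirDeriv u (gen Q m) s x = ∑ i, (u i : ℂ) * genPartial Q m i s x :=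
  (hasDerivAt_gen Q m s hx u).deriv

lemma line_eventually_ne {n : ℕ} {x : V n} (hx : x ≠ 0) (u : V n) :
    ∀ᶠ t : ℝ in nhds 0, x + t • u ≠ 0 := by
  have : Continuous fun t : ℝ => x + t • u := by fun_prop
  exact this.continuousAt.eventually_ne (by simpa using hx)

lemma Symb.differentiableAt_and_dirDeriv {n : ℕ} {d : ℤ} {φ : ℂ → V n → ℂ} (h : Symb d φ)
    (u : V n) : (∀ s x, x ≠ 0 → DifferentiableAt ℝ (fun t : ℝ => φ s (x + t • u)) 0) ∧
      Symb (d - 1) (dirDeriv u φ) := by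
  induction h with
  | gen Q q m hQ hd =>
    refine ⟨fun s x hx => (hasDerivAt_gen Q m s hx u).differentiableAt, ?_⟩
    subst hd
    refine (Symb.sum univ fun i _ =>
      Symb.smul (fun _ => (u i : ℂ)) (by fun_prop) (symb_genPartial hQ m i)).congr ?_
    intro s x hx
    rw [dirDeriv_gen Q m u s hx]
  | add _ _ h1 h2 =>
    refine ⟨fun s x hx => (h1.1 s x hx).add (h2.1 s x hx), (h1.2.add h2.2).congr ?_⟩
    intro s x hx
    exact (deriv_add (h1.1 s x hx) (h2.1 s x hx)).symm
  | smul c hc _ h1 =>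
    refine ⟨fun s x hx => (h1.1 s x hx).const_mul _, (h1.2.smul c hc).congr ?_⟩
    intro s x hx
    exact (deriv_const_mul _ (h1.1 s x hx)).symm
  | @congr φ ψ h0 he h1 =>
    have key : ∀ s x, x ≠ 0 → (fun t : ℝ => φ s (x + t • u)) =ᶠ[nhds 0]
        (fun t : ℝ => ψ s (x + t • u)) := fun s x hx => by
      filter_upwards [line_eventually_ne hx u] with t ht using he s _ ht
    exact ⟨fun s x hx => (h1.1 s x hx).congr_of_eventuallyEq (key s x hx).symm,
      h1.2.congr fun s x hx => (key s x hx).deriv_eq⟩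

lemma Symb.dirDeriv {n : ℕ} {d : ℤ} {φ : ℂ → V n → ℂ} (h : Symb d φ) (u : V n) :
    Symb (d - 1) (dirDeriv u φ) := (h.differentiableAt_and_dirDeriv u).2

lemma Symb.iterate_dirDeriv {n : ℕ} {d : ℤ} {φ : ℂ → V n → ℂ} (h : Symb d φ) (u : V n) (j : ℕ) :
    Symb (d - j) ((EpsteinZeta.dirDeriv u)^[j] φ) := by
  induction j with
  | zero => simpa using h
  | succ j ih =>
    rw [Function.iterate_succ_apply']
    convert ih.dirDeriv u using 1
    push_cast; ring

lemma Symb.hasDerivAt {n : ℕ} {d : ℤ} {φ : ℂ → V n → ℂ} (h : Symb d φ) (u : V n) (s : ℂ)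
    {x : V n} {t : ℝ} (hx : x + t • u ≠ 0) :
    HasDerivAt (fun t : ℝ => φ s (x + t • u)) (EpsteinZeta.dirDeriv u φ s (x + t • u)) t := by
  have h1 := ((h.differentiableAt_and_dirDeriv u).1 s _ hx).hasDerivAt
  have h2 : HasDerivAt (fun r : ℝ => φ s (x + t • u + (r - t) • u))
      (EpsteinZeta.dirDeriv u φ s (x + t • u)) t := by
    have := HasDerivAt.comp_sub_const t t (f := fun t' : ℝ => φ s (x + t • u + t' • u))
      (f' := EpsteinZeta.dirDeriv u φ s (x + t • u)) (by rw [sub_self]; exact h1)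
    exact this
  convert h2 using 3
  rw [sub_smul]; abel

lemma exists_norm_evalReal_le {n : ℕ} {Q : MvPolynomial (Fin n) ℂ} {q : ℕ}
    (hQ : Q.IsHomogeneous q) : ∃ C : ℝ, 0 ≤ C ∧ ∀ x : V n, ‖evalReal Q x‖ ≤ C * ‖x‖ ^ q := by
  refine ⟨∑ e ∈ Q.support, ‖coeff e Q‖, by positivity, fun x => ?_⟩
  rw [evalReal, eval_eq', Finset.sum_mul]
  refine (norm_sum_le _ _).trans (sum_le_sum fun e he => ?_)
  rw [norm_mul, norm_prod]
  refine mul_le_mul_of_nonneg_left ?_ (norm_nonneg _)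
  have hdeg : ∑ i, e i = q := by
    have := hQ (mem_support_iff.1 he)
    rw [Finsupp.weight_apply, Finsupp.sum_fintype _ _ (by simp)] at this
    simpa using this
  rw [← hdeg, ← Finset.prod_pow_eq_pow_sum]
  refine Finset.prod_le_prod (fun _ _ => norm_nonneg _) fun i _ => ?_
  rw [norm_pow, Complex.norm_real]
  exact pow_le_pow_left₀ (norm_nonneg _) (PiLp.norm_apply_le x i) _

lemma norm_exp_log {r : ℝ} (hr : 0 < r) (z : ℂ) :
    ‖Complex.exp (z * (Real.log r : ℂ))‖ = r ^ z.re := by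
  rw [Complex.norm_exp, Complex.re_mul_ofReal, Real.rpow_def_of_pos hr, mul_comm]

lemma Symb.exists_bound {n : ℕ} {d : ℤ} {φ : ℂ → V n → ℂ} (h : Symb d φ) (R : ℝ) :
    ∃ C : ℝ, 0 ≤ C ∧ ∀ s : ℂ, ‖s‖ ≤ R → ∀ x : V n, x ≠ 0 →
      ‖φ s x‖ ≤ C * ‖x‖ ^ ((d : ℝ) - s.re) := by
  induction h with
  | gen Q q m hQ hd =>
    obtain ⟨C, hC, hb⟩ := exists_norm_evalReal_le hQ
    refine ⟨C, hC, fun s _ x hx => ?_⟩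
    have hx' : 0 < ‖x‖ := norm_pos_iff.2 hx
    rw [EpsteinZeta.gen, norm_mul, norm_exp_log hx', hd]
    calc _ ≤ C * ‖x‖ ^ q * ‖x‖ ^ (-(s + 2 * m)).re := by gcongr; exact hb x
      _ = _ := by
        rw [mul_assoc, ← Real.rpow_natCast, ← Real.rpow_add hx']
        congr 2
        simp
        ring
  | add _ _ h1 h2 =>
    obtain ⟨C1, hC1, hb1⟩ := h1
    obtain ⟨C2, hC2, hb2⟩ := h2
    refine ⟨C1 + C2, by positivity, fun s hs x hx => (norm_add_le _ _).trans ?_⟩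
    rw [add_mul]
    exact add_le_add (hb1 s hs x hx) (hb2 s hs x hx)
  | smul c hc _ h1 =>
    obtain ⟨C1, hC1, hb1⟩ := h1
    obtain ⟨B, hB⟩ := (isCompact_closedBall (0 : ℂ) R).exists_bound_of_continuousOn
      hc.continuous.continuousOn
    refine ⟨max B 0 * C1, by positivity, fun s hs x hx => ?_⟩
    rw [norm_mul, mul_assoc]
    exact mul_le_mul ((hB s (by simpa using hs)).trans (le_max_left _ _)) (hb1 s hs x hx)
      (norm_nonneg _) (by positivity)
  | congr _ he h1 =>
    obtain ⟨C, hC, hb⟩ := h1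
    exact ⟨C, hC, fun s hs x hx => he s x hx ▸ hb s hs x hx⟩

lemma Symb.differentiable {n : ℕ} {d : ℤ} {φ : ℂ → V n → ℂ} (h : Symb d φ) {x : V n}
    (hx : x ≠ 0) : Differentiable ℂ fun s => φ s x := by
  induction h with
  | gen Q q m hQ hd => unfold EpsteinZeta.gen; fun_prop
  | add _ _ h1 h2 => exact h1.add h2
  | smul c hc _ h1 => exact hc.mul h1
  | congr _ he h1 => simpa only [he _ x hx] using h1

/-- Euler's identity for `Q(x) ‖x‖^(-s)`. -/
lemma sum_dirDeriv_gen_X_mul {n : ℕ} {Q : MvPolynomial (Fin n) ℂ} {q : ℕ}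
    (hQ : Q.IsHomogeneous q) (s : ℂ) {x : V n} (hx : x ≠ 0) :
    ∑ i, dirDeriv (EuclideanSpace.single i (1 : ℝ)) (gen (X i * Q) 0) s x =
      (n + q - s) * gen Q 0 s x := by
  have hxx : (‖x‖ : ℂ) ^ 2 = ∑ i, (x i : ℂ) ^ 2 := by
    rw [← Complex.ofReal_pow, EuclideanSpace.real_norm_sq_eq]; push_cast; rfl
  have h1 : ∀ i, dirDeriv (EuclideanSpace.single i (1 : ℝ)) (gen (X i * Q) 0) s x =
      genPartial (X i * Q) 0 i s x := fun i => by
    rw [dirDeriv_gen _ _ _ _ hx, Finset.sum_eq_single i]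
    · simp
    · intro b _ hb; simp [hb]
    · simp
  simp only [h1]
  have euler : ∑ i, (x i : ℂ) * evalReal (pderiv i Q) x = q * evalReal Q x := by
    have := congrArg (fun R => evalReal R x) hQ.sum_X_mul_pderiv
    simpa [evalReal] using this
  have e2 := exp_log_norm_shift hx 0 s
  have h2 : ∀ i, genPartial (X i * Q) 0 i s x =
      (evalReal Q x + (x i : ℂ) * evalReal (pderiv i Q) x) *
        Complex.exp (-(s + 2 * (0 : ℕ)) * (Real.log ‖x‖ : ℂ)) +
      (x i : ℂ) ^ 2 * (-s * (evalReal Q x *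
        Complex.exp (-(s + 2 * ((0 + 1 : ℕ) : ℂ)) * (Real.log ‖x‖ : ℂ)))) := fun i => by
    simp only [genPartial, gen, evalReal, Derivation.leibniz, pderiv_X_self, smul_eq_mul, map_add,
      map_mul, eval_X, mul_one]
    push_cast
    ring
  simp only [h2, sum_add_distrib, ← Finset.sum_mul, ← hxx, euler]
  rw [← e2]
  simp only [gen, sum_const, card_univ, Fintype.card_fin, nsmul_eq_mul]
  rw [← e2]
  ring

end

section

open MvPolynomial Finset Filter Topology

lemma summable_norm_int_rpow {ι : Type*} [Fintype ι] {r : ℝ} (hr : r < -(Fintype.card ι : ℝ)) :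
    Summable fun k : ι → ℤ => ‖fun i => (k i : ℝ)‖ ^ r := by
  set b := Pi.basisFun ℝ ι
  set L : Submodule ℤ (ι → ℝ) := Submodule.span ℤ (Set.range b)
  have hrank : Module.finrank ℤ L = Fintype.card ι := by
    rw [ZLattice.rank ℝ L, Module.finrank_fintype_fun_eq_card]
  have h := ZLattice.summable_norm_rpow (L := L) r (by rw [hrank]; exact hr)
  have hmem : ∀ k : ι → ℤ, (fun i => (k i : ℝ)) ∈ L := fun k => by
    rw [Module.Basis.mem_span_iff_repr_mem]
    intro i
    exact ⟨k i, by simp [b]⟩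
  refine h.comp_injective (i := fun k : ι → ℤ => (⟨fun i => (k i : ℝ), hmem k⟩ : L)) ?_
  intro k l hkl
  ext i
  have h' : (k i : ℝ) = l i := congrFun (Subtype.ext_iff.1 hkl) i
  exact_mod_cast h'

/-- An integer vector as a point of Euclidean space. -/
def intVec {n : ℕ} (k : Fin n → ℤ) : V n := WithLp.toLp 2 fun i => (k i : ℝ)

lemma intVec_apply {n : ℕ} (k : Fin n → ℤ) (i : Fin n) : intVec k i = (k i : ℝ) := rfl

lemma intVec_add {n : ℕ} (k l : Fin n → ℤ) : intVec (k + l) = intVec k + intVec l := by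
  ext i; simp [intVec]

lemma intVec_ne_zero {n : ℕ} {k : Fin n → ℤ} : intVec k ≠ 0 ↔ k ≠ 0 := by
  refine not_congr ⟨fun h => ?_, fun h => ?_⟩
  · ext i
    have : intVec k i = (0 : V n) i := by rw [h]
    simpa [intVec] using this
  · ext i; simp [h, intVec]

lemma norm_intVec {n : ℕ} (k : Fin n → ℤ) : ‖intVec k‖ = euclNorm k := by
  rw [EuclideanSpace.norm_eq, euclNorm]; simp [intVec]

lemma abs_le_norm_intVec {n : ℕ} (k : Fin n → ℤ) (i : Fin n) : |(k i : ℝ)| ≤ ‖intVec k‖ :=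
  PiLp.norm_apply_le (intVec k) i

lemma one_le_norm_intVec {n : ℕ} {k : Fin n → ℤ} (hk : k ≠ 0) : 1 ≤ ‖intVec k‖ := by
  obtain ⟨i, hi⟩ := Function.ne_iff.1 hk
  refine le_trans ?_ (abs_le_norm_intVec k i)
  exact_mod_cast Int.one_le_abs hi

lemma summable_norm_intVec_rpow {n : ℕ} {r : ℝ} (hr : r < -(n : ℝ)) :
    Summable fun k : Fin n → ℤ => ‖intVec k‖ ^ r := by
  have h := summable_norm_int_rpow (ι := Fin n) (r := r) (by simpa using hr)
  have hr0 : r < 0 := hr.trans_le (by simp)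
  refine h.of_nonneg_of_le (fun k => by positivity) fun k => ?_
  rcases eq_or_ne k 0 with rfl | hk
  · have : intVec (0 : Fin n → ℤ) = 0 := by ext i; simp [intVec]
    rw [this, norm_zero, Real.zero_rpow hr0.ne]
    positivity
  · obtain ⟨i, hi⟩ := Function.ne_iff.1 hk
    refine Real.rpow_le_rpow_of_nonpos (norm_pos_iff.2 ?_) ?_ hr0.le
    · intro h0
      exact hi (by simpa using congrFun h0 i)
    · exact (pi_norm_le_iff_of_nonneg (norm_nonneg _)).2 fun i => abs_le_norm_intVec k i

lemma eventually_cofinite_lt_norm_intVec {n : ℕ} (B : ℝ) :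
    ∀ᶠ k : Fin n → ℤ in cofinite, B < ‖intVec k‖ := by
  rw [eventually_cofinite]
  refine (Set.finite_Icc (fun _ : Fin n => -⌈B⌉) (fun _ => ⌈B⌉)).subset fun k hk => ?_
  have hk' : ‖intVec k‖ ≤ B := not_lt.1 hk
  have h : ∀ i, |(k i : ℝ)| ≤ ⌈B⌉ := fun i =>
    (abs_le_norm_intVec k i).trans (hk'.trans (Int.le_ceil B))
  have h' : ∀ i, |k i| ≤ ⌈B⌉ := fun i => by exact_mod_cast h i
  exact ⟨fun i => (abs_le.1 (h' i)).1, fun i => (abs_le.1 (h' i)).2⟩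

/-- The character `exp(2π i k·a)`. -/
def chr {n : ℕ} (a : Fin n → ℝ) (k : Fin n → ℤ) : ℂ :=
  Complex.exp (2 * Real.pi * Complex.I * (pair k a : ℂ))

lemma norm_chr {n : ℕ} (a : Fin n → ℝ) (k : Fin n → ℤ) : ‖chr a k‖ = 1 := by
  rw [chr, show 2 * (Real.pi : ℂ) * Complex.I * (pair k a : ℂ) =
    ((2 * Real.pi * pair k a : ℝ) : ℂ) * Complex.I by push_cast; ring]
  exact Complex.norm_exp_ofReal_mul_I _

lemma pair_add {n : ℕ} (k l : Fin n → ℤ) (a : Fin n → ℝ) :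
    pair (k + l) a = pair k a + pair l a := by
  simp [pair, add_mul, sum_add_distrib]

lemma chr_add {n : ℕ} (a : Fin n → ℝ) (k l : Fin n → ℤ) :
    chr a (k + l) = chr a k * chr a l := by
  rw [chr, chr, chr, ← Complex.exp_add, pair_add]
  congr 1; push_cast; ring

/-- A family of functions analytic on `Re s > τ`, the `a`-th one being locally bounded by a
multiple of `W a`, uniformly in `a`. -/
structure UnifAnalytic {ι : Type*} (τ : ℝ) (W : ι → ℝ) (E : ι → ℂ → ℂ) : Prop where
  differentiableOn : ∀ a, DifferentiableOn ℂ (E a) {s | τ < s.re}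
  bound : ∀ z : ℂ, τ < z.re → ∃ C : ℝ, 0 ≤ C ∧ ∀ᶠ s in 𝓝 z, ∀ a, ‖E a s‖ ≤ C * W a

lemma isOpen_halfPlane (τ : ℝ) : IsOpen {s : ℂ | τ < s.re} :=
  isOpen_lt continuous_const Complex.continuous_re

namespace UnifAnalytic

variable {ι : Type*} {τ : ℝ} {W : ι → ℝ} {E E' : ι → ℂ → ℂ}

lemma mono {τ' : ℝ} {W' : ι → ℝ} (h : UnifAnalytic τ W E) (hτ : τ ≤ τ') (hW : ∀ a, W a ≤ W' a) :
    UnifAnalytic τ' W' E where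
  differentiableOn a := (h.differentiableOn a).mono fun _ hs => lt_of_le_of_lt hτ hs
  bound z hz := by
    obtain ⟨C, hC, hb⟩ := h.bound z (hτ.trans_lt hz)
    refine ⟨C, hC, hb.mono fun s hs a => (hs a).trans ?_⟩
    exact mul_le_mul_of_nonneg_left (hW a) hC

lemma add (h : UnifAnalytic τ W E) (h' : UnifAnalytic τ W E') :
    UnifAnalytic τ W fun a s => E a s + E' a s where
  differentiableOn a := (h.differentiableOn a).add (h'.differentiableOn a)
  bound z hz := by
    obtain ⟨C, hC, hb⟩ := h.bound z hz
    obtain ⟨C', hC', hb'⟩ := h'.bound z hz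
    refine ⟨C + C', by positivity, ?_⟩
    filter_upwards [hb, hb'] with s h1 h2 a
    rw [add_mul]
    exact (norm_add_le _ _).trans (add_le_add (h1 a) (h2 a))

lemma zero : UnifAnalytic τ W fun _ _ => 0 where
  differentiableOn a := by fun_prop
  bound z hz := ⟨0, le_rfl, by simp⟩

lemma const_mul (c : ι → ℂ) (h : UnifAnalytic τ W E) {W' : ι → ℝ}
    (hW : ∀ a, ‖c a‖ * W a ≤ W' a) : UnifAnalytic τ W' fun a s => c a * E a s where
  differentiableOn a := (h.differentiableOn a).const_mul _
  bound z hz := by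
    obtain ⟨C, hC, hb⟩ := h.bound z hz
    refine ⟨C, hC, hb.mono fun s hs a => ?_⟩
    rw [norm_mul]
    calc _ ≤ ‖c a‖ * (C * W a) := mul_le_mul_of_nonneg_left (hs a) (norm_nonneg _)
      _ = C * (‖c a‖ * W a) := by ring
      _ ≤ _ := mul_le_mul_of_nonneg_left (hW a) hC

lemma sum {κ : Type*} (t : Finset κ) {E : κ → ι → ℂ → ℂ}
    (h : ∀ j ∈ t, UnifAnalytic τ W (E j)) : UnifAnalytic τ W fun a s => ∑ j ∈ t, E j a s := by
  classical
  induction t using Finset.induction_on with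
  | empty => simpa using zero
  | insert a t ha ih =>
    simp only [Finset.sum_insert ha]
    exact (h a (by simp)).add (ih fun i hi => h i (by simp [hi]))

end UnifAnalytic

/-- Terms of size `O(‖k‖^(e - Re s))`, locally uniformly in `s`. -/
def HasOrder {n : ℕ} (e : ℝ) (r : (Fin n → ℤ) → ℂ → ℂ) : Prop :=
  ∀ R : ℝ, ∃ C : ℝ, 0 ≤ C ∧ ∀ᶠ k in cofinite, ∀ s : ℂ, ‖s‖ ≤ R →
    ‖r k s‖ ≤ C * ‖intVec k‖ ^ (e - s.re)

lemma summable_of_eventually_eq {κ : Type*} {b b' : κ → ℝ} (hb : Summable b)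
    (h : ∀ᶠ k in cofinite, b' k = b k) : Summable b' :=
  (summable_congr_cofinite (f := b') (g := b) h).2 hb

lemma HasOrder.exists_summable_bound {n : ℕ} {e : ℝ} {r : (Fin n → ℤ) → ℂ → ℂ}
    (hr : HasOrder e r) (hd : ∀ k, Differentiable ℂ (r k)) {z : ℂ} (hz : n + e < z.re) :
    ∃ U ∈ 𝓝 z, IsOpen U ∧ ∃ b : (Fin n → ℤ) → ℝ, Summable b ∧
      ∀ k, ∀ s ∈ U, ‖r k s‖ ≤ b k := by
  classical
  set η := (z.re - n - e) / 2 with hη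
  have hη0 : 0 < η := by rw [hη]; linarith
  obtain ⟨C, hC, hb⟩ := hr (‖z‖ + 1)
  set U : Set ℂ := Metric.ball z 1 ∩ {s | z.re - η < s.re} with hU
  have hUo : IsOpen U := Metric.isOpen_ball.inter (isOpen_halfPlane _)
  have hzU : z ∈ U := ⟨Metric.mem_ball_self one_pos, by simpa using hη0⟩
  choose B hB using fun k => (isCompact_closedBall z 1).exists_bound_of_continuousOn
    (hd k).continuous.continuousOn
  have hgood : ∀ᶠ k : Fin n → ℤ in cofinite, ∀ s ∈ U,
      ‖r k s‖ ≤ C * ‖intVec k‖ ^ (-n - η) := by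
    filter_upwards [hb, eventually_cofinite_lt_norm_intVec 1] with k hk hk1 s hs
    have hs1 : ‖s‖ ≤ ‖z‖ + 1 := by
      have h1 : ‖s - z‖ < 1 := mem_ball_iff_norm.1 hs.1
      have h2 := norm_add_le z (s - z)
      rw [add_sub_cancel] at h2
      linarith
    refine (hk s hs1).trans (mul_le_mul_of_nonneg_left ?_ hC)
    refine Real.rpow_le_rpow_of_exponent_le hk1.le ?_
    have : z.re - η < s.re := hs.2
    linarith
  have hsum : Summable fun k : Fin n → ℤ => C * ‖intVec k‖ ^ (-n - η) :=
    (summable_norm_intVec_rpow (by linarith)).mul_left C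
  set b : (Fin n → ℤ) → ℝ := fun k =>
    if ∀ s ∈ U, ‖r k s‖ ≤ C * ‖intVec k‖ ^ (-n - η) then C * ‖intVec k‖ ^ (-n - η) else B k
  refine ⟨U, hUo.mem_nhds hzU, hUo, b, ?_, fun k s hs => ?_⟩
  · refine summable_of_eventually_eq hsum (hgood.mono fun k hk => if_pos hk)
  · by_cases h : ∀ s ∈ U, ‖r k s‖ ≤ C * ‖intVec k‖ ^ (-n - η)
    · simp only [b, if_pos h]; exact h s hs
    · simp only [b, if_neg h]
      exact hB k s (Metric.ball_subset_closedBall hs.1)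

lemma HasOrder.summable_norm {n : ℕ} {e : ℝ} {r : (Fin n → ℤ) → ℂ → ℂ}
    (hr : HasOrder e r) (hd : ∀ k, Differentiable ℂ (r k)) {s : ℂ} (hs : n + e < s.re) :
    Summable fun k => ‖r k s‖ := by
  obtain ⟨U, hU, -, b, hb, hle⟩ := hr.exists_summable_bound hd hs
  exact hb.of_nonneg_of_le (fun _ => norm_nonneg _) fun k => hle k s (mem_of_mem_nhds hU)

lemma HasOrder.summable_mul_chr {n : ℕ} {e : ℝ} {r : (Fin n → ℤ) → ℂ → ℂ}
    (hr : HasOrder e r) (hd : ∀ k, Differentiable ℂ (r k)) (a : Fin n → ℝ) {s : ℂ}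
    (hs : n + e < s.re) : Summable fun k => r k s * chr a k := by
  refine Summable.of_norm ?_
  simpa [norm_chr] using hr.summable_norm hd hs

lemma HasOrder.unifAnalytic {n : ℕ} {e : ℝ} {r : (Fin n → ℤ) → ℂ → ℂ}
    (hr : HasOrder e r) (hd : ∀ k, Differentiable ℂ (r k)) :
    UnifAnalytic (n + e) (fun _ => 1) fun (a : Fin n → ℝ) s => ∑' k, r k s * chr a k where
  differentiableOn a z hz := by
    obtain ⟨U, hU, hUo, b, hb, hle⟩ := hr.exists_summable_bound hd hz
    have h := Complex.differentiableOn_tsum_of_summable_norm (F := fun k s => r k s * chr a k) hb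
      (fun k => ((hd k).mul_const _).differentiableOn) hUo
      (fun k s hs => by simpa [norm_chr] using hle k s hs)
    exact ((h.differentiableAt hU)).differentiableWithinAt
  bound z hz := by
    obtain ⟨U, hU, hUo, b, hb, hle⟩ := hr.exists_summable_bound hd hz
    refine ⟨∑' k, b k, tsum_nonneg fun k =>
      (norm_nonneg _).trans (hle k z (mem_of_mem_nhds hU)), ?_⟩
    filter_upwards [hU] with s hs a
    rw [mul_one]
    exact tsum_of_norm_bounded hb.hasSum fun k => by simpa [norm_chr] using hle k s hs

/-- The restriction of `φ s` to the lattice, with the value `0` at the origin. -/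
def latt {n : ℕ} (φ : ℂ → V n → ℂ) (k : Fin n → ℤ) (s : ℂ) : ℂ :=
  if k = 0 then 0 else φ s (intVec k)

lemma Symb.differentiable_latt {n : ℕ} {d : ℤ} {φ : ℂ → V n → ℂ} (h : Symb d φ)
    (k : Fin n → ℤ) : Differentiable ℂ (latt φ k) := by
  unfold latt
  split_ifs with hk
  · fun_prop
  · exact h.differentiable (intVec_ne_zero.2 hk)

lemma Symb.hasOrder {n : ℕ} {d : ℤ} {φ : ℂ → V n → ℂ} (h : Symb d φ) :
    HasOrder (d : ℝ) (latt φ) := fun R => by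
  obtain ⟨C, hC, hb⟩ := h.exists_bound R
  refine ⟨C, hC, Eventually.of_forall fun k s hs => ?_⟩
  unfold latt
  split_ifs with hk
  · rw [norm_zero]; positivity
  · exact hb s hs _ (intVec_ne_zero.2 hk)

/-- The series `∑_{k ≠ 0} φ s k exp(2π i k·a)`. -/
def lattSum {n : ℕ} (φ : ℂ → V n → ℂ) (a : Fin n → ℝ) (s : ℂ) : ℂ :=
  ∑' k, latt φ k s * chr a k

lemma norm_sub_taylor_le (M : ℕ) (f : ℕ → ℝ → ℂ) (C : ℝ)
    (hf : ∀ j < M, ∀ t ∈ Set.Icc (0 : ℝ) 1, HasDerivAt (f j) (f (j + 1) t) t)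
    (hC : ∀ t ∈ Set.Icc (0 : ℝ) 1, ‖f M t‖ ≤ C) (t : ℝ) (ht : t ∈ Set.Icc (0 : ℝ) 1) :
    ‖f 0 t - ∑ j ∈ range M, ((t ^ j / j.factorial : ℝ) : ℂ) * f j 0‖ ≤ C := by
  induction M generalizing f t with
  | zero => simpa using hC t ht
  | succ M ih =>
    have ih' := ih (fun j => f (j + 1)) (fun j hj t ht => hf (j + 1) (by omega) t ht) hC
    have hC0 : 0 ≤ C := (norm_nonneg _).trans (hC t ht)
    set G : ℝ → ℂ := fun t => f 0 t - ∑ j ∈ range (M + 1), ((t ^ j / j.factorial : ℝ) : ℂ) * f j 0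
      with hG
    have hder : ∀ t ∈ Set.Icc (0 : ℝ) 1, HasDerivAt G
        (f 1 t - ∑ j ∈ range M, ((t ^ j / j.factorial : ℝ) : ℂ) * f (j + 1) 0) t := by
      intro t ht
      refine (hf 0 (by omega) t ht).sub ?_
      simp only [Finset.sum_range_succ']
      simp only [pow_zero, Nat.factorial_zero, Nat.cast_one, div_one]
      refine HasDerivAt.add_const _ (HasDerivAt.fun_sum fun j _ => ?_)
      refine HasDerivAt.mul_const ?_ _
      refine HasDerivAt.ofReal_comp ?_
      have := (hasDerivAt_pow (j + 1) t).div_const ((j + 1).factorial : ℝ)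
      refine this.congr_deriv ?_
      rw [Nat.factorial_succ]
      have : ((j : ℝ) + 1) ≠ 0 := by positivity
      have : (j.factorial : ℝ) ≠ 0 := by positivity
      push_cast
      field_simp
    have h := (convex_Icc (0 : ℝ) 1).norm_image_sub_le_of_norm_hasDerivWithin_le
      (fun x hx => (hder x hx).hasDerivWithinAt) (fun x hx => ih' x hx)
      (Set.left_mem_Icc.2 zero_le_one) ht
    have hG0 : G 0 = 0 := by
      simp only [hG, Finset.sum_range_succ']
      simp
    rw [hG0, sub_zero, sub_zero] at h
    refine h.trans ?_
    rw [Real.norm_of_nonneg ht.1]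
    exact mul_le_of_le_one_right hC0 ht.2

lemma half_norm_le_norm_add_smul {n : ℕ} {x u : V n} (hx : 2 * ‖u‖ < ‖x‖) {t : ℝ}
    (ht : t ∈ Set.Icc (0 : ℝ) 1) : ‖x‖ / 2 ≤ ‖x + t • u‖ ∧ ‖x + t • u‖ ≤ 2 * ‖x‖ := by
  have h1 : ‖t • u‖ ≤ ‖u‖ := by
    rw [norm_smul, Real.norm_of_nonneg ht.1]
    exact mul_le_of_le_one_left (norm_nonneg _) ht.2
  have h2 := norm_add_le x (t • u)
  have h3 := norm_sub_le (x + t • u) (t • u)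
  rw [add_sub_cancel_right] at h3
  have := norm_nonneg u
  constructor <;> linarith

lemma rpow_le_of_half_le {r r' : ℝ} (hr : 0 < r) (h1 : r / 2 ≤ r') (h2 : r' ≤ 2 * r) {e E : ℝ}
    (he : |e| ≤ E) : r' ^ e ≤ 2 ^ E * r ^ e := by
  have hr' : 0 < r' := by linarith
  rcases le_or_gt 0 e with h0 | h0
  · calc r' ^ e ≤ (2 * r) ^ e := Real.rpow_le_rpow hr'.le h2 h0
      _ = 2 ^ e * r ^ e := Real.mul_rpow (by norm_num) hr.le
      _ ≤ _ := by
        gcongr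
        · norm_num
        · exact (le_abs_self e).trans he
  · calc r' ^ e ≤ (r / 2) ^ e := Real.rpow_le_rpow_of_nonpos (by linarith) h1 h0.le
      _ = 2 ^ (-e) * r ^ e := by
        rw [Real.div_rpow hr.le (by norm_num), Real.rpow_neg (by norm_num)]
        ring
      _ ≤ _ := by
        gcongr
        · norm_num
        · exact (neg_le_abs e).trans he

/-- The Taylor remainder of a shift by `u`. -/
def shiftRem {n : ℕ} (φ : ℂ → V n → ℂ) (u : Fin n → ℤ) (M : ℕ) (k : Fin n → ℤ) (s : ℂ) : ℂ :=
  latt φ (k + u) s - ∑ j ∈ range M,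
    (1 / j.factorial : ℂ) * latt ((dirDeriv (intVec u))^[j] φ) k s

lemma Symb.differentiable_shiftRem {n : ℕ} {d : ℤ} {φ : ℂ → V n → ℂ} (h : Symb d φ)
    (u : Fin n → ℤ) (M : ℕ) (k : Fin n → ℤ) : Differentiable ℂ (shiftRem φ u M k) := by
  unfold shiftRem
  refine (h.differentiable_latt _).sub (Differentiable.fun_sum fun j _ => ?_)
  exact ((h.iterate_dirDeriv (intVec u) j).differentiable_latt k).const_mul _

lemma Symb.hasOrder_shiftRem {n : ℕ} {d : ℤ} {φ : ℂ → V n → ℂ} (h : Symb d φ)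
    (u : Fin n → ℤ) (M : ℕ) : HasOrder ((d : ℝ) - M) (shiftRem φ u M) := fun R => by
  obtain ⟨C, hC, hb⟩ := (h.iterate_dirDeriv (intVec u) M).exists_bound R
  refine ⟨C * 2 ^ (|(d : ℝ) - M| + R), by positivity, ?_⟩
  filter_upwards [eventually_cofinite_lt_norm_intVec (2 * ‖intVec u‖)] with k hk s hs
  have hk0 : 0 < ‖intVec k‖ := lt_of_le_of_lt (by positivity) hk
  have hne : ∀ t ∈ Set.Icc (0 : ℝ) 1, intVec k + t • intVec u ≠ 0 := fun t ht => by
    rw [← norm_pos_iff]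
    linarith [(half_norm_le_norm_add_smul hk ht).1]
  have hkne : k ≠ 0 := intVec_ne_zero.1 (norm_pos_iff.1 hk0)
  have hkune : k + u ≠ 0 := by
    rw [← intVec_ne_zero, intVec_add]
    simpa using hne 1 (by simp)
  have key := norm_sub_taylor_le M
    (fun j t => (EpsteinZeta.dirDeriv (intVec u))^[j] φ s (intVec k + t • intVec u))
    (C * 2 ^ (|(d : ℝ) - M| + R) * ‖intVec k‖ ^ ((d : ℝ) - M - s.re))
    (fun j _ t ht => by
      simp only [Function.iterate_succ_apply']
      exact (h.iterate_dirDeriv (intVec u) j).hasDerivAt _ _ (hne t ht))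
    (fun t ht => by
      refine (hb s hs _ (hne t ht)).trans ?_
      rw [mul_assoc]
      refine mul_le_mul_of_nonneg_left ?_ hC
      have h12 := half_norm_le_norm_add_smul hk ht
      push_cast
      refine rpow_le_of_half_le hk0 h12.1 h12.2 ?_
      exact (abs_sub _ _).trans (by linarith [(Complex.abs_re_le_norm s).trans hs]))
    1 (by simp)
  refine le_of_eq_of_le ?_ key
  congr 1
  simp only [shiftRem, latt, if_neg hkne, if_neg hkune, intVec_add, one_smul, zero_smul,
    add_zero, one_pow, Function.iterate_zero, id]
  push_cast
  rfl

lemma lattSum_unifAnalytic {n : ℕ} {d : ℤ} {φ : ℂ → V n → ℂ} (h : Symb d φ) :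
    UnifAnalytic (n + d) (fun _ => 1) fun (a : Fin n → ℝ) s => lattSum φ a s :=
  h.hasOrder.unifAnalytic h.differentiable_latt

lemma tsum_shift_mul_chr {n : ℕ} (r : (Fin n → ℤ) → ℂ) (a : Fin n → ℝ) (u : Fin n → ℤ) :
    ∑' k, r (k + u) * chr a k = chr a (-u) * ∑' k, r k * chr a k := by
  rw [← (Equiv.addRight u).tsum_eq (fun k => r k * chr a k), ← tsum_mul_left]
  refine tsum_congr fun k => ?_
  have : chr a (k + u) * chr a (-u) = chr a k := by rw [← chr_add]; simp
  simp only [Equiv.coe_addRight]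
  rw [← this]; ring

/-- The expansion of a shifted series. -/
lemma Symb.shift_expansion {n : ℕ} {d : ℤ} {φ : ℂ → V n → ℂ} (h : Symb d φ)
    (u : Fin n → ℤ) (M : ℕ) (a : Fin n → ℝ) {s : ℂ} (hs : (n : ℝ) + d < s.re) :
    chr a (-u) * lattSum φ a s = ∑ j ∈ range M,
      (1 / j.factorial : ℂ) * lattSum ((EpsteinZeta.dirDeriv (intVec u))^[j] φ) a s +
      ∑' k, shiftRem φ u M k s * chr a k := by
  have hj : ∀ j, Summable fun k =>
      latt ((EpsteinZeta.dirDeriv (intVec u))^[j] φ) k s * chr a k := fun j => by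
    have h' := h.iterate_dirDeriv (intVec u) j
    refine h'.hasOrder.summable_mul_chr h'.differentiable_latt a ?_
    have : (0 : ℝ) ≤ j := by positivity
    push_cast
    linarith
  have hM : Summable fun k => shiftRem φ u M k s * chr a k := by
    refine (h.hasOrder_shiftRem u M).summable_mul_chr (h.differentiable_shiftRem u M) a ?_
    have : (0 : ℝ) ≤ M := by positivity
    linarith
  rw [lattSum, ← tsum_shift_mul_chr (fun k => latt φ k s)]
  simp only [lattSum, ← tsum_mul_left]
  rw [← Summable.tsum_finsetSum fun j _ => (hj j).mul_left _, ← Summable.tsum_add _ hM]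
  · refine tsum_congr fun k => ?_
    simp only [shiftRem, sub_mul, Finset.sum_mul, mul_assoc]
    ring
  · exact summable_sum fun j _ => (hj j).mul_left _

end

section

open MvPolynomial Finset Filter Topology

lemma term_eq_gen {n : ℕ} (P : MvPolynomial (Fin n) ℂ) (a : Fin n → ℝ) (s : ℂ)
    {k : Fin n → ℤ} (hk : k ≠ 0) : term P a s k = latt (gen P 0) k s * chr a k := by
  have h0 : 0 < euclNorm k := by
    rw [← norm_intVec]; exact zero_lt_one.trans_le (one_le_norm_intVec hk)
  have hne : (euclNorm k : ℂ) ≠ 0 := by exact_mod_cast h0.ne'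
  rw [term, latt, if_neg hk, chr, gen, norm_intVec, Complex.cpow_def_of_ne_zero hne,
    ← Complex.ofReal_log h0.le, div_eq_mul_inv, ← Complex.exp_neg]
  simp only [evalReal, intVec_apply, Complex.ofReal_intCast]
  congr 3
  push_cast; ring

lemma f_eq_lattSum {n : ℕ} (P : MvPolynomial (Fin n) ℂ) (a : Fin n → ℝ) (s : ℂ) :
    f P a s = lattSum (gen P 0) a s := by
  rw [f, lattSum]
  have h := tsum_subtype {k : Fin n → ℤ | k ≠ 0} fun k => latt (gen P 0) k s * chr a k
  have h2 : (∑' k : {k : Fin n → ℤ // k ≠ 0}, term P a s k.1) =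
      ∑' k : {k : Fin n → ℤ | k ≠ 0}, latt (gen P 0) k.1 s * chr a k.1 :=
    tsum_congr fun k => term_eq_gen P a s k.2
  rw [h2, h]
  refine tsum_congr fun k => ?_
  by_cases hk : k = 0
  · simp [hk, latt]
  · simp [hk]

lemma symb_gen_zero {n p : ℕ} {P : MvPolynomial (Fin n) ℂ} (hP : P.IsHomogeneous p) :
    Symb (p : ℤ) (gen P 0) := Symb.gen P p 0 hP (by simp)

lemma summable_term {n p : ℕ} {P : MvPolynomial (Fin n) ℂ} (hP : P.IsHomogeneous p)
    (a : Fin n → ℝ) {s : ℂ} (hs : (n + p : ℝ) < s.re) :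
    Summable fun k : {k : Fin n → ℤ // k ≠ 0} => term P a s k.1 := by
  have h := symb_gen_zero hP
  have h1 := h.hasOrder.summable_mul_chr h.differentiable_latt a (s := s) (by simpa using hs)
  have h2 := h1.comp_injective (i := ((↑) : {k : Fin n → ℤ // k ≠ 0} → Fin n → ℤ))
    Subtype.val_injective
  exact h2.congr fun k => (term_eq_gen P a s k.2).symm

lemma eqOn_halfPlane {τ ρ : ℝ} {E h : ℂ → ℂ} (hE : DifferentiableOn ℂ E {s | τ < s.re})
    (hh : DifferentiableOn ℂ h {s | τ < s.re}) (he : ∀ s : ℂ, ρ < s.re → E s = h s) :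
    Set.EqOn E h {s | τ < s.re} := by
  have hpre : IsPreconnected {s : ℂ | τ < s.re} := (convex_halfSpace_re_gt τ).isPreconnected
  have hz : ((max τ ρ + 1 : ℝ) : ℂ) ∈ {s : ℂ | τ < s.re} := by
    simp only [Set.mem_ofPred_eq, Complex.ofReal_re]
    linarith [le_max_left τ ρ]
  refine (hE.analyticOnNhd (isOpen_halfPlane τ)).eqOn_of_preconnected_of_eventuallyEq
    (hh.analyticOnNhd (isOpen_halfPlane τ)) hpre hz ?_
  filter_upwards [(isOpen_halfPlane ρ).mem_nhds (x := ((max τ ρ + 1 : ℝ) : ℂ))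
    (by simp only [Set.mem_ofPred_eq, Complex.ofReal_re]; linarith [le_max_right τ ρ])] with s hs
  exact he s hs

/-- Analytic continuations to the half-planes `Re s > σ - N` glue to an entire function. -/
lemma hasEntireExtension_of_forall {σ : ℝ} {h : ℂ → ℂ}
    (hh : DifferentiableOn ℂ h {s | σ < s.re})
    (hE : ∀ N : ℕ, ∃ E : ℂ → ℂ, DifferentiableOn ℂ E {s | σ - N < s.re} ∧
      ∃ ρ : ℝ, ∀ s : ℂ, ρ < s.re → E s = h s) : HasEntireExtension σ h := by
  choose E hEd ρ hρ using hE
  have hcompat : ∀ M N : ℕ, M ≤ N → ∀ s : ℂ, σ - M < s.re → E N s = E M s := by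
    intro M N hMN s hs
    have hMN' : (M : ℝ) ≤ N := by exact_mod_cast hMN
    refine eqOn_halfPlane (ρ := max (ρ M) (ρ N)) ((hEd N).mono fun z hz => ?_) (hEd M)
      (fun z hz => ?_) hs
    · simp only [Set.mem_ofPred_eq] at hz ⊢; linarith
    · rw [hρ N z ((le_max_right _ _).trans_lt hz), hρ M z ((le_max_left _ _).trans_lt hz)]
  have hex : ∀ s : ℂ, ∃ N : ℕ, σ - N < s.re := fun s => by
    obtain ⟨N, hN⟩ := exists_nat_gt (σ - s.re)
    exact ⟨N, by linarith⟩
  choose N hN using hex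
  have hval : ∀ M : ℕ, ∀ s : ℂ, σ - M < s.re → E (N s) s = E M s := fun M s hs => by
    rcases le_total M (N s) with hle | hle
    · exact hcompat _ _ hle s hs
    · exact (hcompat _ _ hle s (hN s)).symm
  refine ⟨fun s => E (N s) s, fun z => ?_, fun s hs => ?_⟩
  · have h1 := (hEd (N z)).differentiableAt ((isOpen_halfPlane _).mem_nhds (hN z))
    refine h1.congr_of_eventuallyEq ?_
    filter_upwards [(isOpen_halfPlane _).mem_nhds (hN z)] with s hs using hval _ s hs
  · have h0 : σ - (0 : ℕ) < s.re := by simpa using hs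
    refine (hval 0 s h0).trans ?_
    exact eqOn_halfPlane (ρ := ρ 0) (by simpa using hEd 0) hh (hρ 0) hs

/-- Continuation of `lattSum φ a` when `u·a` is not an integer. -/
lemma exists_unifAnalytic_lattSum {n : ℕ} (u : Fin n → ℤ) (N : ℕ) :
    ∀ {d : ℤ} {φ : ℂ → V n → ℂ}, Symb d φ → ∃ E : (Fin n → ℝ) → ℂ → ℂ,
      UnifAnalytic ((n : ℝ) + d - N) (fun a => (1 + ‖(chr a (-u) - 1)⁻¹‖) ^ N) E ∧
      ∀ a, chr a (-u) ≠ 1 → ∀ s : ℂ, (n : ℝ) + d < s.re → E a s = lattSum φ a s := by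
  induction N with
  | zero =>
    intro d φ h
    exact ⟨lattSum φ, by simpa using lattSum_unifAnalytic h, fun _ _ _ _ => rfl⟩
  | succ N ih =>
    intro d φ h
    choose E hE hagree using fun j : ℕ => ih (h.iterate_dirDeriv (intVec u) (j + 1))
    set H : (Fin n → ℝ) → ℂ → ℂ := fun a s => ∑' k, shiftRem φ u (N + 1) k s * chr a k
    have hH := (h.hasOrder_shiftRem u (N + 1)).unifAnalytic (h.differentiable_shiftRem u (N + 1))
    have hW1 : ∀ a : Fin n → ℝ, 1 ≤ (1 + ‖(chr a (-u) - 1)⁻¹‖) ^ N := fun a =>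
      one_le_pow₀ (by linarith [norm_nonneg (chr a (-u) - 1)⁻¹])
    have hsum : UnifAnalytic ((n : ℝ) + d - (N + 1 : ℕ))
        (fun a => (1 + ‖(chr a (-u) - 1)⁻¹‖) ^ N)
        (fun a s => (∑ j ∈ range N, (1 / (j + 1).factorial : ℂ) * E j a s) + H a s) := by
      refine UnifAnalytic.add (UnifAnalytic.sum _ fun j _ => ?_) (hH.mono ?_ hW1)
      · have h1 : UnifAnalytic ((n : ℝ) + d - (N + 1 : ℕ)) _ (E j) :=
          (hE j).mono (by
            have : (0 : ℝ) ≤ j := by positivity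
            push_cast; linarith) (fun a => le_rfl)
        refine h1.const_mul (fun _ => (1 / (j + 1).factorial : ℂ)) fun a => ?_
        refine mul_le_of_le_one_left (by positivity) ?_
        rw [norm_div, norm_one, Complex.norm_natCast, div_le_one (by positivity)]
        exact_mod_cast Nat.succ_le_of_lt (Nat.factorial_pos _)
      · linarith
    refine ⟨_, hsum.const_mul (fun a => (chr a (-u) - 1)⁻¹) fun a => ?_, fun a ha s hs => ?_⟩
    · rw [pow_succ, mul_comm]
      exact mul_le_mul_of_nonneg_left (by linarith) (by positivity)
    · have hexp := h.shift_expansion u (N + 1) a hs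
      rw [sum_range_succ'] at hexp
      have hne : chr a (-u) - 1 ≠ 0 := sub_ne_zero.2 ha
      have hEj : ∀ j, E j a s = lattSum ((dirDeriv (intVec u))^[j + 1] φ) a s := fun j => by
        refine hagree j a ha s ?_
        have : (0 : ℝ) ≤ j := by positivity
        push_cast; linarith
      simp only [hEj]
      rw [inv_mul_eq_iff_eq_mul₀ hne, sub_mul, hexp]
      simp only [Function.iterate_zero, id, Nat.factorial_zero, Nat.cast_one, H]
      ring

/-- Continuation of the sum of a derivative over the lattice. -/
lemma exists_differentiableOn_lattSum_dirDeriv {n : ℕ} (u : Fin n → ℤ) (N : ℕ) :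
    ∀ {d : ℤ} {φ : ℂ → V n → ℂ}, Symb d φ → ∃ E : ℂ → ℂ,
      DifferentiableOn ℂ E {s | (n : ℝ) + d - 1 - N < s.re} ∧
      ∀ s : ℂ, (n : ℝ) + d < s.re → E s = lattSum (dirDeriv (intVec u) φ) 0 s := by
  induction N with
  | zero =>
    intro d φ h
    refine ⟨_, ((lattSum_unifAnalytic (h.dirDeriv (intVec u))).differentiableOn 0).mono
      fun s hs => ?_, fun _ _ => rfl⟩
    simp only [Set.mem_ofPred_eq, Nat.cast_zero] at hs ⊢
    push_cast; linarith
  | succ N ih =>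
    intro d φ h
    choose E hE hagree using fun j : ℕ => ih (h.iterate_dirDeriv (intVec u) (j + 1))
    set H : ℂ → ℂ := fun s => ∑' k, shiftRem φ u (N + 2) k s * chr 0 k
    have hH := ((h.hasOrder_shiftRem u (N + 2)).unifAnalytic
      (h.differentiable_shiftRem u (N + 2))).differentiableOn 0
    refine ⟨fun s => -((∑ j ∈ range N, (1 / (j + 2).factorial : ℂ) * E j s) + H s), ?_, ?_⟩
    · refine (DifferentiableOn.add (DifferentiableOn.fun_sum fun j _ =>
        ((hE j).mono fun s hs => ?_).const_mul _) (hH.mono fun s hs => ?_)).neg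
      · have : (0 : ℝ) ≤ j := by positivity
        simp only [Set.mem_ofPred_eq] at hs ⊢
        push_cast at hs ⊢; linarith
      · simp only [Set.mem_ofPred_eq] at hs ⊢
        push_cast at hs ⊢; linarith
    · intro s hs
      have hexp := h.shift_expansion u (N + 2) 0 hs
      rw [sum_range_succ', sum_range_succ'] at hexp
      have hEj : ∀ j, E j s = lattSum ((dirDeriv (intVec u))^[j + 2] φ) 0 s := fun j => by
        rw [Function.iterate_succ_apply']
        refine hagree j s ?_
        have : (0 : ℝ) ≤ j := by positivity
        push_cast; linarith
      have hchr : chr (0 : Fin n → ℝ) (-u) = 1 := by simp [chr, pair]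
      simp only [hEj]
      rw [hchr] at hexp
      simp only [Function.iterate_zero, id, Nat.factorial_zero, Nat.cast_one, zero_add,
        Function.iterate_one, Nat.factorial_one, div_one, one_mul, add_assoc,
        Nat.reduceAdd] at hexp
      simp only [H]
      linear_combination hexp

/-- The function `(n + p - s) f_0(s)` extends to an entire function. -/
lemma hasEntireExtension_mul_lattSum {n p : ℕ} {P : MvPolynomial (Fin n) ℂ}
    (hP : P.IsHomogeneous p) : HasEntireExtension (n + p : ℝ)
      fun s => (n + p - s) * lattSum (gen P 0) 0 s := by
  have hs0 := symb_gen_zero hP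
  have hX : ∀ i : Fin n, Symb ((p : ℤ) + 1) (gen (X i * P) 0) := fun i =>
    Symb.gen _ (1 + p) 0 ((isHomogeneous_X ℂ i).mul hP) (by push_cast; ring)
  refine hasEntireExtension_of_forall ?_ fun N => ?_
  · refine DifferentiableOn.mul (by fun_prop) ?_
    simpa using (lattSum_unifAnalytic hs0).differentiableOn 0
  · choose E hE hagree using fun i : Fin n =>
      exists_differentiableOn_lattSum_dirDeriv (Pi.single i 1) N (hX i)
    refine ⟨fun s => ∑ i, E i s, DifferentiableOn.fun_sum fun i _ => (hE i).mono fun s hs => ?_,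
      n + p + 1, fun s hs => ?_⟩
    · simp only [Set.mem_ofPred_eq] at hs ⊢
      push_cast; linarith
    · have hsing : ∀ i : Fin n, intVec (Pi.single i 1) = EuclideanSpace.single i (1 : ℝ) :=
        fun i => by
          ext j
          by_cases hj : j = i
          · subst hj; simp [intVec]
          · simp [intVec, hj]
      have hEi : ∀ i, E i s = lattSum (dirDeriv (EuclideanSpace.single i (1 : ℝ))
          (gen (X i * P) 0)) 0 s := fun i => by
        rw [hagree i s (by push_cast; linarith), hsing]
      simp only [hEi, lattSum]
      rw [← Summable.tsum_finsetSum, ← tsum_mul_left]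
      · refine tsum_congr fun k => ?_
        rw [← Finset.sum_mul, ← mul_assoc]
        congr 1
        unfold latt
        split_ifs with hk
        · simp
        · exact sum_dirDeriv_gen_X_mul hP s (intVec_ne_zero.2 hk)
      · intro i _
        have h' := (hX i).dirDeriv (EuclideanSpace.single i (1 : ℝ))
        refine h'.hasOrder.summable_mul_chr h'.differentiable_latt 0 ?_
        push_cast; linarith

end

section

open MvPolynomial Finset Filter Topology MeasureTheory

/-- The unit cube with least vertex `k`. -/
def cube {n : ℕ} (k : Fin n → ℤ) : Set (V n) := {x | ∀ i, ⌊x i⌋ = k i}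

lemma measurableSet_cube {n : ℕ} (k : Fin n → ℤ) : MeasurableSet (cube k) := by
  have : cube k = ⋂ i, (fun x : V n => ⌊x i⌋) ⁻¹' {k i} := by ext; simp [cube]
  rw [this]
  refine MeasurableSet.iInter fun i => ?_
  have h : Measurable fun x : V n => ⌊x i⌋ := Int.measurable_floor.comp (by fun_prop)
  exact h (measurableSet_singleton _)

lemma volume_cube {n : ℕ} (k : Fin n → ℤ) : volume (cube k) = 1 := by
  have h : cube k = (WithLp.ofLp : V n → Fin n → ℝ) ⁻¹'
      (Set.univ.pi fun i => Set.Ico (k i : ℝ) (k i + 1)) := by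
    ext x
    simp [cube, Int.floor_eq_iff]
  rw [h, (PiLp.volume_preserving_ofLp (Fin n)).measure_preimage
    (MeasurableSet.univ_pi fun i => measurableSet_Ico).nullMeasurableSet, volume_pi_pi]
  simp

lemma iUnion_cube {n : ℕ} : ⋃ k : Fin n → ℤ, cube k = Set.univ :=
  Set.eq_univ_of_forall fun x => Set.mem_iUnion.2 ⟨fun i => ⌊x i⌋, fun _ => rfl⟩

lemma pairwise_disjoint_cube {n : ℕ} :
    Pairwise (Function.onFun Disjoint fun k : Fin n → ℤ => cube k) := by
  intro k l hkl
  refine Set.disjoint_left.2 fun x hx hy => hkl ?_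
  ext i
  rw [← hx i, hy i]

lemma norm_sub_intVec_le {n : ℕ} {k : Fin n → ℤ} {x : V n} (hx : x ∈ cube k) :
    ‖x - intVec k‖ ≤ n ∧ ∀ i, |(x - intVec k) i| ≤ 1 := by
  have h1 : ∀ i, |(x - intVec k) i| ≤ 1 := fun i => by
    have : (x - intVec k) i = Int.fract (x i) := by
      rw [PiLp.sub_apply, intVec_apply, ← hx i, Int.fract]
    rw [this, abs_of_nonneg (Int.fract_nonneg _)]
    exact (Int.fract_lt_one _).le
  refine ⟨?_, h1⟩
  rcases Nat.eq_zero_or_pos n with rfl | hn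
  · simp [Subsingleton.elim x (intVec k)]
  have hn' : (1 : ℝ) ≤ n := by exact_mod_cast hn
  refine abs_le_of_sq_le_sq' ?_ (by positivity) |>.2
  rw [EuclideanSpace.real_norm_sq_eq]
  calc ∑ i, (x - intVec k) i ^ 2 ≤ ∑ i : Fin n, (1 : ℝ) :=
        sum_le_sum fun i _ => by rw [← sq_abs]; exact pow_le_one₀ (abs_nonneg _) (h1 i)
    _ = n := by simp
    _ ≤ _ := by nlinarith

lemma evalReal_smul {n p : ℕ} {P : MvPolynomial (Fin n) ℂ} (hP : P.IsHomogeneous p) (r : ℝ)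
    (x : V n) : evalReal P (r • x) = (r : ℂ) ^ p * evalReal P x := by
  rw [evalReal, evalReal, eval_eq', eval_eq', Finset.mul_sum]
  refine sum_congr rfl fun e he => ?_
  have hdeg : ∑ i, e i = p := by
    have := hP (mem_support_iff.1 he)
    rw [Finsupp.weight_apply, Finsupp.sum_fintype _ _ (by simp)] at this
    simpa using this
  rw [← hdeg, ← Finset.prod_pow_eq_pow_sum, mul_left_comm, ← Finset.prod_mul_distrib]
  congr 1
  refine prod_congr rfl fun i _ => ?_
  rw [PiLp.smul_apply, smul_eq_mul, Complex.ofReal_mul, mul_pow]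

lemma measurable_gen {n : ℕ} (P : MvPolynomial (Fin n) ℂ) (s : ℂ) :
    Measurable fun x : V n => gen P 0 s x := by
  unfold gen evalReal
  refine Measurable.mul ?_ ?_
  · exact ((MvPolynomial.continuous_eval P).comp (by fun_prop)).measurable
  · fun_prop

/-- The function `P(x) ‖x‖^(-s)` outside the unit ball. -/
def genOut {n : ℕ} (P : MvPolynomial (Fin n) ℂ) (s : ℂ) (x : V n) : ℂ :=
  if 1 < ‖x‖ then gen P 0 s x else 0

lemma measurable_genOut {n : ℕ} (P : MvPolynomial (Fin n) ℂ) (s : ℂ) :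
    Measurable fun x : V n => genOut P s x :=
  Measurable.ite (measurableSet_lt measurable_const measurable_norm) (measurable_gen P s)
    measurable_const

lemma integrable_genOut {n p : ℕ} (hn : 1 ≤ n) {P : MvPolynomial (Fin n) ℂ}
    (hP : P.IsHomogeneous p) {s : ℂ} (hs : (n + p : ℝ) < s.re) :
    Integrable fun x : V n => genOut P s x := by
  have : Nonempty (Fin n) := ⟨⟨0, hn⟩⟩
  obtain ⟨C, hC, hb⟩ := (symb_gen_zero hP).exists_bound ‖s‖
  have h1 : Integrable fun x : V n => (Set.Ioi (1 : ℝ)).indicator (fun r => r ^ (p - s.re)) ‖x‖ := by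
    rw [integrable_fun_norm_addHaar]
    have h2 : IntegrableOn (fun r : ℝ => r ^ ((n : ℝ) - 1 + p - s.re)) (Set.Ioi 1) :=
      integrableOn_Ioi_rpow_of_lt (by linarith) one_pos
    rw [← integrable_indicator_iff measurableSet_Ioi] at h2
    refine (h2.congr (Eventually.of_forall fun r => ?_)).integrableOn
    by_cases hr : 1 < r
    · have hr0 : 0 < r := by linarith
      simp only [Set.indicator, Set.mem_Ioi, hr, if_true, finrank_euclideanSpace,
        Fintype.card_fin, smul_eq_mul]
      rw [← Real.rpow_natCast, ← Real.rpow_add hr0, Nat.cast_sub hn]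
      congr 1; push_cast; ring
    · simp [Set.indicator, hr]
  refine (h1.const_mul C).mono' (measurable_genOut P s).aestronglyMeasurable
    (Eventually.of_forall fun x => ?_)
  unfold genOut
  split_ifs with hx
  · have hx0 : x ≠ 0 := norm_pos_iff.1 (by linarith)
    simpa [Set.indicator, hx] using hb s le_rfl x hx0
  · rw [norm_zero]
    refine mul_nonneg hC (Set.indicator_nonneg (fun r hr => ?_) _)
    have : (0 : ℝ) < r := zero_lt_one.trans hr
    positivity

lemma integral_genOut {n p : ℕ} (hn : 1 ≤ n) {P : MvPolynomial (Fin n) ℂ}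
    (hP : P.IsHomogeneous p) {s : ℝ} (hs : (n + p : ℝ) < s) :
    ∫ x : V n, genOut P s x = sphereIntegral P * ((s - (n + p) : ℝ) : ℂ)⁻¹ := by
  have : Nonempty (Fin n) := ⟨⟨0, hn⟩⟩
  set h : ℝ → ℂ := (Set.Ioi (1 : ℝ)).indicator fun r => ((r ^ (p - s) : ℝ) : ℂ) with hh
  have hpolar : ∀ (u : V n) (r : ℝ), ‖u‖ = 1 → 0 < r →
      genOut P s (r • u) = evalReal P u * h r := by
    intro u r hu hr
    have hnorm : ‖r • u‖ = r := by rw [norm_smul, hu, mul_one, Real.norm_of_nonneg hr.le]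
    by_cases h1 : 1 < r
    · simp only [genOut, hnorm, h1, if_true, gen, evalReal_smul hP, hh, Set.indicator, Set.mem_Ioi]
      rw [Real.rpow_sub hr, Real.rpow_natCast, div_eq_mul_inv, ← Real.rpow_neg hr.le,
        Real.rpow_def_of_pos hr]
      push_cast
      rw [show -((s : ℂ) + 2 * 0) * (Real.log r : ℂ) = (Real.log r : ℂ) * -(s : ℂ) by ring]
      ring
    · simp [genOut, hnorm, h1, hh]
  calc ∫ x : V n, genOut P s x
      = ∫ x : ({(0)}ᶜ : Set (V n)), genOut P s x.1 ∂((volume : Measure (V n)).comap Subtype.val) := by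
        rw [integral_subtype_comap (measurableSet_singleton _).compl fun x => genOut P s x,
          restrict_compl_singleton]
    _ = ∫ x : Metric.sphere (0 : V n) 1 × Set.Ioi (0 : ℝ), evalReal P x.1.1 * h x.2.1
          ∂(volume : Measure (V n)).toSphere.prod (.volumeIoiPow (Module.finrank ℝ (V n) - 1)) := by
        rw [← ((volume : Measure (V n)).measurePreserving_homeomorphUnitSphereProd).integral_comp
          (Homeomorph.measurableEmbedding _)]
        refine integral_congr_ae (Eventually.of_forall fun x => ?_)
        have hx0 : 0 < ‖x.1‖ := norm_pos_iff.2 x.2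
        have := hpolar (((homeomorphUnitSphereProd (V n)) x).1.1)
          (((homeomorphUnitSphereProd (V n)) x).2.1)
          (by simpa using ((homeomorphUnitSphereProd (V n)) x).1.2)
          ((homeomorphUnitSphereProd (V n)) x).2.2
        simp only
        rw [← this]
        congr 1
        simp only [homeomorphUnitSphereProd_apply_fst_coe, homeomorphUnitSphereProd_apply_snd_coe]
        rw [smul_smul, mul_inv_cancel₀ hx0.ne', one_smul]
    _ = sphereIntegral P *
          ∫ r : Set.Ioi (0 : ℝ), h r ∂.volumeIoiPow (Module.finrank ℝ (V n) - 1) :=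
        integral_prod_mul (fun u : Metric.sphere (0 : V n) 1 => evalReal P u.1)
          (fun r : Set.Ioi (0 : ℝ) => h r.1)
    _ = sphereIntegral P * ∫ r in Set.Ioi (0 : ℝ), ((r ^ (n - 1) : ℝ) : ℂ) * h r := by
        congr 1
        simp only [Measure.volumeIoiPow, ENNReal.ofReal]
        rw [integral_withDensity_eq_integral_smul, finrank_euclideanSpace, Fintype.card_fin,
          integral_subtype_comap measurableSet_Ioi fun a => Real.toNNReal (a ^ (n - 1)) • h a]
        · refine setIntegral_congr_fun measurableSet_Ioi fun x hx => ?_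
          rw [NNReal.smul_def, Real.coe_toNNReal _ (pow_nonneg (le_of_lt hx) _),
            Complex.real_smul]
        · exact (measurable_subtype_coe.pow_const _).real_toNNReal
    _ = sphereIntegral P * ∫ r in Set.Ioi (1 : ℝ), ((r ^ ((n : ℝ) - 1 + p - s) : ℝ) : ℂ) := by
        congr 1
        have e : (fun r : ℝ => ((r ^ (n - 1) : ℝ) : ℂ) * h r) = (Set.Ioi (1 : ℝ)).indicator
            fun r => ((r ^ ((n : ℝ) - 1 + p - s) : ℝ) : ℂ) := by
          ext r
          by_cases hr : 1 < r
          · have hr0 : 0 < r := by linarith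
            simp only [hh, Set.indicator, Set.mem_Ioi, hr, if_true]
            rw [← Complex.ofReal_mul, ← Real.rpow_natCast, ← Real.rpow_add hr0, Nat.cast_sub hn]
            congr 2; push_cast; ring
          · simp [hh, Set.indicator, hr]
        rw [e, setIntegral_indicator measurableSet_Ioi]
        congr 2
        ext r
        simp only [Set.mem_inter_iff, Set.mem_Ioi]
        exact ⟨fun h => h.2, fun h => ⟨by linarith, h⟩⟩
    _ = _ := by
        rw [integral_complex_ofReal, integral_Ioi_rpow_of_lt (by linarith) one_pos,
          Real.one_rpow, ← Complex.ofReal_inv]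
        congr 2
        rw [neg_div, one_div, ← inv_neg]
        congr 1; ring

lemma exists_bound_genPartial {n p : ℕ} {P : MvPolynomial (Fin n) ℂ} (hP : P.IsHomogeneous p)
    (R : ℝ) : ∃ C : ℝ, 0 ≤ C ∧ ∀ s : ℂ, ‖s‖ ≤ R → ∀ x : V n, x ≠ 0 → ∀ u : V n,
      (∀ i, |u i| ≤ 1) → ‖dirDeriv u (gen P 0) s x‖ ≤ C * ‖x‖ ^ ((p : ℝ) - 1 - s.re) := by
  choose C hC hb using fun i : Fin n => (symb_genPartial hP 0 i).exists_bound R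
  refine ⟨∑ i, C i, sum_nonneg fun i _ => hC i, fun s hs x hx u hu => ?_⟩
  rw [dirDeriv_gen _ _ _ _ hx, Finset.sum_mul]
  refine (norm_sum_le _ _).trans (sum_le_sum fun i _ => ?_)
  rw [norm_mul, Complex.norm_real]
  refine (mul_le_of_le_one_left (norm_nonneg _) (hu i)).trans ?_
  simpa using hb i s hs x hx

/-- Uniform comparison of the lattice terms with the integrals over the cubes. -/
lemma exists_summable_bound_latt_sub_integral {n p : ℕ} {P : MvPolynomial (Fin n) ℂ}
    (hP : P.IsHomogeneous p) : ∃ b : (Fin n → ℤ) → ℝ, Summable b ∧ ∀ s : ℝ,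
      (n + p : ℝ) < s → s ≤ n + p + 1 → ∀ k,
      ‖latt (gen P 0) k s - ∫ x in cube k, genOut P s x‖ ≤ b k := by
  classical
  set R : ℝ := n + p + 1 with hR
  obtain ⟨C, hC, hb⟩ := (symb_gen_zero hP).exists_bound R
  obtain ⟨C', hC', hb'⟩ := exists_bound_genPartial hP R
  set B : ℝ := 2 * n + 2 with hB
  set D : ℝ := C' * 2 ^ (R + R) with hD
  have hreal : ∀ k : Fin n → ℤ, volume.real (cube k) = 1 := fun k => by
    simp [Measure.real, volume_cube]
  have hint : ∀ (k : Fin n → ℤ) (g : V n → ℂ) (A : ℝ), (∀ x ∈ cube k, ‖g x‖ ≤ A) →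
      ‖∫ x in cube k, g x‖ ≤ A := fun k g A hA => by
    have := norm_setIntegral_le_of_norm_le_const (μ := volume) (by simp [volume_cube]) hA
    rwa [hreal, mul_one] at this
  have hsmall : ∀ s : ℝ, (n + p : ℝ) < s → s ≤ n + p + 1 → ∀ x : V n, 1 ≤ ‖x‖ →
      ‖gen P 0 s x‖ ≤ C := fun s hs hs1 x hx => by
    have hs0 : 0 ≤ s := le_trans (by positivity) hs.le
    refine (hb s (by rw [Complex.norm_real, Real.norm_of_nonneg hs0]; exact hs1) x
      (norm_pos_iff.1 (by linarith))).trans ?_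
    refine mul_le_of_le_one_right hC (Real.rpow_le_one_of_one_le_of_nonpos hx ?_)
    have : (0 : ℝ) ≤ n := by positivity
    simp only [Complex.ofReal_re, Int.cast_natCast]
    linarith
  refine ⟨fun k => if B < ‖intVec k‖ then D * ‖intVec k‖ ^ (-(n : ℝ) - 1) else 2 * C, ?_, ?_⟩
  · refine summable_of_eventually_eq ((summable_norm_intVec_rpow
      (r := -(n : ℝ) - 1) (by linarith)).mul_left D) ?_
    filter_upwards [eventually_cofinite_lt_norm_intVec B] with k hk using if_pos hk
  intro s hs hs1 k
  have hs0 : 0 ≤ s := le_trans (by positivity) hs.le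
  have hsR : ‖(s : ℂ)‖ ≤ R := by rw [Complex.norm_real, Real.norm_of_nonneg hs0]; exact hs1
  have hn0 : (0 : ℝ) ≤ n := by positivity
  have hp0 : (0 : ℝ) ≤ p := by positivity
  beta_reduce
  split_ifs with hk
  · have hk1 : 1 ≤ ‖intVec k‖ := by linarith
    have hk0 : k ≠ 0 := intVec_ne_zero.1 (norm_pos_iff.1 (by linarith))
    have e : latt (gen P 0) k s - ∫ x in cube k, genOut P s x =
        ∫ x in cube k, (gen P 0 s (intVec k) - genOut P s x) := by
      have hn : 1 ≤ n := Nat.one_le_iff_ne_zero.2 fun h => by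
        subst h
        exact hk0 (Subsingleton.elim k 0)
      have h1 : IntegrableOn (fun _ : V n => gen P 0 s (intVec k)) (cube k) :=
        integrableOn_const (by simp [volume_cube])
      have h2 : IntegrableOn (fun x : V n => genOut P s x) (cube k) :=
        (integrable_genOut hn hP (s := s) (by simpa using hs)).integrableOn
      rw [integral_sub h1 h2, setIntegral_const, hreal,
        one_smul, latt, if_neg hk0]
    rw [e]
    refine hint k _ _ fun x hx => ?_
    obtain ⟨hu1, hu2⟩ := norm_sub_intVec_le hx
    set u : V n := x - intVec k with hu
    have hxu : x = intVec k + (1 : ℝ) • u := by rw [one_smul, hu]; abel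
    have huk : 2 * ‖u‖ < ‖intVec k‖ := by linarith
    have hseg := fun t ht => half_norm_le_norm_add_smul huk (t := t) ht
    have hne : ∀ t ∈ Set.Icc (0 : ℝ) 1, intVec k + t • u ≠ 0 := fun t ht => by
      rw [← norm_pos_iff]; linarith [(hseg t ht).1]
    have hx1 : 1 < ‖x‖ := by
      have := (hseg 1 (by simp)).1
      rw [← hxu] at this
      linarith
    have key := (convex_Icc (0 : ℝ) 1).norm_image_sub_le_of_norm_hasDerivWithin_le
      (f := fun t : ℝ => gen P 0 s (intVec k + t • u))
      (f' := fun t : ℝ => dirDeriv u (gen P 0) s (intVec k + t • u))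
      (C := D * ‖intVec k‖ ^ (-(n : ℝ) - 1))
      (fun t ht => ((symb_gen_zero hP).hasDerivAt u s (hne t ht)).hasDerivWithinAt)
      (fun t ht => by
        refine (hb' s hsR _ (hne t ht) u hu2).trans ?_
        rw [hD, mul_assoc]
        refine mul_le_mul_of_nonneg_left ?_ hC'
        refine (rpow_le_of_half_le (E := R + R) (by linarith) (hseg t ht).1 (hseg t ht).2 ?_).trans
          (mul_le_mul_of_nonneg_left (Real.rpow_le_rpow_of_exponent_le hk1 ?_) (by positivity))
        · rw [Complex.ofReal_re, abs_le]
          constructor <;> linarith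
        · rw [Complex.ofReal_re]; linarith)
      (Set.left_mem_Icc.2 zero_le_one) (Set.right_mem_Icc.2 zero_le_one)
    rw [genOut, if_pos hx1, norm_sub_rev]
    simp only [one_smul, zero_smul, add_zero, sub_zero, norm_one, mul_one] at key hxu
    rwa [← hxu] at key
  · refine (norm_sub_le _ _).trans ?_
    rw [two_mul]
    refine add_le_add ?_ (hint k _ _ fun x _ => ?_)
    · unfold latt
      split_ifs with hk0
      · simpa using hC
      · exact hsmall s hs hs1 _ (one_le_norm_intVec hk0)
    · unfold genOut
      split_ifs with hx
      · exact hsmall s hs hs1 x hx.le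
      · simpa using hC

/-- The residue of `f_0` at `n + p`, as a limit along the real axis. -/
lemma tendsto_sub_mul_lattSum {n p : ℕ} (hn : 1 ≤ n) {P : MvPolynomial (Fin n) ℂ}
    (hP : P.IsHomogeneous p) :
    Tendsto (fun s : ℝ => ((s - (n + p) : ℝ) : ℂ) * lattSum (gen P 0) 0 s)
      (𝓝[>] (n + p : ℝ)) (𝓝 (sphereIntegral P)) := by
  obtain ⟨b, hb, hle⟩ := exists_summable_bound_latt_sub_integral hP
  rw [tendsto_iff_norm_sub_tendsto_zero]
  have hlim : Tendsto (fun s : ℝ => (s - (n + p)) * ∑' k, b k) (𝓝[>] (n + p : ℝ)) (𝓝 0) := by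
    have : Tendsto (fun s : ℝ => (s - (n + p)) * ∑' k, b k) (𝓝 (n + p : ℝ))
        (𝓝 (((n + p : ℝ) - (n + p)) * ∑' k, b k)) :=
      Continuous.tendsto (by fun_prop) _
    rw [sub_self, zero_mul] at this
    exact this.mono_left nhdsWithin_le_nhds
  refine squeeze_zero' (Eventually.of_forall fun s => norm_nonneg _) ?_ hlim
  filter_upwards [Ioc_mem_nhdsGT (show (n + p : ℝ) < n + p + 1 by linarith)] with s hs
  have hs0 : 0 < s - (n + p) := sub_pos.2 hs.1
  have hI := integrable_genOut hn hP (s := s) (by simpa using hs.1)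
  have h1 := hasSum_integral_iUnion (f := fun x : V n => genOut P s x) (μ := volume)
    (fun k => measurableSet_cube k) pairwise_disjoint_cube hI.integrableOn
  rw [iUnion_cube, setIntegral_univ, integral_genOut hn hP hs.1] at h1
  have hsym := symb_gen_zero hP
  have h2 := (hsym.hasOrder.summable_mul_chr hsym.differentiable_latt 0 (s := s)
    (by simpa using hs.1)).hasSum
  have h3 := h2.sub h1
  have hchr : ∀ k, chr (0 : Fin n → ℝ) k = 1 := fun k => by simp [chr, pair]
  simp only [hchr, mul_one] at h3
  have h4 : ‖lattSum (gen P 0) 0 s - sphereIntegral P * ((s - (n + p) : ℝ) : ℂ)⁻¹‖ ≤ ∑' k, b k := by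
    simp only [lattSum, hchr, mul_one]
    rw [← h3.tsum_eq]
    exact tsum_of_norm_bounded hb.hasSum fun k => hle s hs.1 hs.2 k
  have hne : ((s - (n + p) : ℝ) : ℂ) ≠ 0 := by exact_mod_cast hs0.ne'
  have e : ((s - (n + p) : ℝ) : ℂ) * lattSum (gen P 0) 0 s - sphereIntegral P =
      ((s - (n + p) : ℝ) : ℂ) *
        (lattSum (gen P 0) 0 s - sphereIntegral P * ((s - (n + p) : ℝ) : ℂ)⁻¹) := by
    field_simp
  rw [e, norm_mul, Complex.norm_real, Real.norm_of_nonneg hs0.le]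
  exact mul_le_mul_of_nonneg_left h4 hs0.le

end

section

open MvPolynomial Finset Filter Topology

/-- An entire function `E` divided by `s - c` has residue `E c` at `c`. -/
lemma hasResidueAt_div {E : ℂ → ℂ} (hE : Differentiable ℂ E) (c : ℂ) :
    HasResidueAt (fun z => (z - c)⁻¹ * E z) c (E c) := by
  refine ⟨?_, 1, one_pos, fun ρ hρ _ => ?_⟩
  · have h1 : MeromorphicAt E c := (hE.analyticAt c).meromorphicAt
    fun_prop
  · have := (hE.diffContOnCl (s := Metric.ball c ρ)).circleIntegral_sub_inv_smul
      (Metric.mem_ball_self hρ)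
    simpa using this

lemma tsum_unifAnalytic {ι κ : Type*} {τ : ℝ} {W : ι → ℝ} {E : ι → ℂ → ℂ}
    (h : UnifAnalytic τ W E) (a : κ → ι) (c : κ → ℂ) (hc : Summable fun l => ‖c l‖ * W (a l)) :
    DifferentiableOn ℂ (fun s => ∑' l, c l * E (a l) s) {s | τ < s.re} ∧
      ∀ s : ℂ, τ < s.re → Summable fun l => c l * E (a l) s := by
  have key : ∀ z : ℂ, τ < z.re → ∃ U ∈ 𝓝 z, IsOpen U ∧ U ⊆ {s | τ < s.re} ∧
      ∃ b : κ → ℝ, Summable b ∧ ∀ l, ∀ s ∈ U, ‖c l * E (a l) s‖ ≤ b l := fun z hz => by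
    obtain ⟨C, hC, hb⟩ := h.bound z hz
    obtain ⟨U, hU, hUo, hzU⟩ := mem_nhds_iff.1 (hb.and ((isOpen_halfPlane τ).mem_nhds hz))
    refine ⟨U, hUo.mem_nhds hzU, hUo, fun s hs => (hU hs).2, _, hc.mul_left C, fun l s hs => ?_⟩
    rw [norm_mul]
    calc _ ≤ ‖c l‖ * (C * W (a l)) := mul_le_mul_of_nonneg_left ((hU hs).1 _) (norm_nonneg _)
      _ = _ := by ring
  refine ⟨fun z hz => ?_, fun z hz => ?_⟩
  · obtain ⟨U, hU, hUo, hUs, b, hb, hle⟩ := key z hz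
    exact ((Complex.differentiableOn_tsum_of_summable_norm hb
      (fun l => ((h.differentiableOn (a l)).mono hUs).const_mul _) hUo
      hle).differentiableAt hU).differentiableWithinAt
  · obtain ⟨U, hU, hUo, hUs, b, hb, hle⟩ := key z hz
    exact hb.of_norm_bounded fun l => hle l z (mem_of_mem_nhds hU)

lemma chr_eq_one_iff {n : ℕ} (a : Fin n → ℝ) (k : Fin n → ℤ) :
    chr a k = 1 ↔ ∃ m : ℤ, pair k a = m := by
  rw [chr, Complex.exp_eq_one_iff]
  refine exists_congr fun m => ⟨fun h => ?_, fun h => by rw [h]; push_cast; ring⟩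
  have h' : (2 * Real.pi * Complex.I) * (pair k a : ℂ) = (2 * Real.pi * Complex.I) * (m : ℂ) := by
    rw [h]; ring
  have := mul_left_cancel₀ Complex.two_pi_I_ne_zero h'
  exact_mod_cast this

lemma f_of_isIntegerVector {n : ℕ} (P : MvPolynomial (Fin n) ℂ) {a : Fin n → ℝ}
    (ha : IsIntegerVector a) (s : ℂ) : f P a s = lattSum (gen P 0) 0 s := by
  obtain ⟨m, hm⟩ := ha
  rw [f_eq_lattSum, lattSum, lattSum]
  refine tsum_congr fun k => ?_
  have h1 : chr a k = 1 := (chr_eq_one_iff a k).2 ⟨∑ i, k i * m i, by simp [pair, hm]⟩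
  have h2 : chr (0 : Fin n → ℝ) k = 1 := by simp [chr, pair]
  rw [h1, h2]

/-- The continuation of `f_0` is an entire function divided by `s - (n + p)`. -/
lemma exists_entire_div {n p : ℕ} (hn : 1 ≤ n) {P : MvPolynomial (Fin n) ℂ}
    (hP : P.IsHomogeneous p) : ∃ E : ℂ → ℂ, Differentiable ℂ E ∧ E (n + p) = sphereIntegral P ∧
      ∀ s : ℂ, (n + p : ℝ) < s.re → (s - (n + p))⁻¹ * E s = lattSum (gen P 0) 0 s := by
  obtain ⟨E, hE, hagree⟩ := hasEntireExtension_mul_lattSum hP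
  refine ⟨fun s => -E s, hE.neg, ?_, fun s hs => ?_⟩
  · have h1 := tendsto_sub_mul_lattSum hn hP
    have h2 : Tendsto (fun s : ℝ => -E (s : ℂ)) (𝓝[>] (n + p : ℝ)) (𝓝 (-E ((n + p : ℝ) : ℂ))) :=
      ((hE.continuous.comp Complex.continuous_ofReal).neg.tendsto _).mono_left nhdsWithin_le_nhds
    have h3 := tendsto_nhds_unique (h2.congr' ?_) h1
    · simpa using h3
    · filter_upwards [self_mem_nhdsWithin] with s hs
      rw [hagree s (by simpa using hs)]
      push_cast; ring
  · have hne : s - (n + p) ≠ 0 := fun h => by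
      rw [sub_eq_zero.1 h] at hs
      simp at hs
    rw [inv_mul_eq_iff_eq_mul₀ hne]
    simp only [hagree s hs]
    ring

lemma not_hasEntireExtension_iff {n p : ℕ} (hn : 1 ≤ n) {P : MvPolynomial (Fin n) ℂ}
    (hP : P.IsHomogeneous p) :
    ¬ HasEntireExtension (n + p : ℝ) (lattSum (gen P 0) 0) ↔ sphereIntegral P ≠ 0 := by
  refine not_congr ⟨?_, fun h0 => ?_⟩
  · rintro ⟨F, hF, hagree⟩
    have h1 := tendsto_sub_mul_lattSum hn hP
    have h2 : Tendsto (fun s : ℝ => ((s - (n + p) : ℝ) : ℂ) * F s) (𝓝[>] (n + p : ℝ))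
        (𝓝 (((n + p - (n + p) : ℝ) : ℂ) * F ((n + p : ℝ) : ℂ))) := by
      have hc : Continuous fun s : ℝ => ((s - (n + p) : ℝ) : ℂ) * F s :=
        (Complex.continuous_ofReal.comp (by fun_prop)).mul
          (hF.continuous.comp Complex.continuous_ofReal)
      exact (hc.tendsto _).mono_left nhdsWithin_le_nhds
    rw [sub_self, Complex.ofReal_zero, zero_mul] at h2
    refine tendsto_nhds_unique h1 (h2.congr' ?_)
    filter_upwards [self_mem_nhdsWithin] with s hs
    rw [hagree s (by simpa using hs)]
  · obtain ⟨E, hE, hval, hagree⟩ := exists_entire_div hn hP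
    refine ⟨dslope E (n + p), ?_, fun s hs => ?_⟩
    · rw [← differentiableOn_univ, Complex.differentiableOn_dslope univ_mem]
      exact hE.differentiableOn
    · have hne : s ≠ n + p := fun h => by
        rw [h] at hs
        simp at hs
      rw [dslope_of_ne _ hne, slope_def_field, hval, h0, sub_zero, ← hagree s hs, div_eq_inv_mul]

lemma hasEntireExtension_of_not_isIntegerVector {n p : ℕ} {P : MvPolynomial (Fin n) ℂ}
    (hP : P.IsHomogeneous p) {a : Fin n → ℝ} (ha : ¬ IsIntegerVector a) :
    HasEntireExtension (n + p : ℝ) (f P a) := by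
  have hex : ∃ i, ∀ m : ℤ, a i ≠ m := by
    by_contra! h
    exact ha ⟨fun i => (h i).choose, fun i => (h i).choose_spec⟩
  obtain ⟨i, hi⟩ := hex
  have hchr : chr a (-Pi.single i 1) ≠ 1 := by
    rw [Ne, chr_eq_one_iff]
    rintro ⟨m, hm⟩
    refine hi (-m) ?_
    have : pair (-Pi.single i 1) a = -a i := by
      rw [pair, Finset.sum_eq_single i]
      · simp
      · intro b _ hb; simp [hb]
      · simp
    rw [this] at hm
    push_cast; linarith
  have hs := symb_gen_zero hP
  rw [show f P a = lattSum (gen P 0) a from funext fun s => f_eq_lattSum P a s]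
  refine hasEntireExtension_of_forall (by simpa using (lattSum_unifAnalytic hs).differentiableOn a)
    fun N => ?_
  obtain ⟨E, hE, hagree⟩ := exists_unifAnalytic_lattSum (Pi.single i 1) N hs
  exact ⟨E a, by simpa using hE.differentiableOn a, n + p,
    fun s hs => hagree a hchr s (by simpa using hs)⟩

lemma exists_summable_one_add_norm_pow_inv (q n : ℕ) :
    ∃ N : ℕ, Summable fun l : Fin q → Fin n → ℤ => ((1 + ‖l‖) ^ N)⁻¹ := by
  refine ⟨q * n + 1, ?_⟩
  have h := summable_norm_int_rpow (ι := Fin q × Fin n) (r := -((q * n + 1 : ℕ) : ℝ))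
    (by simp)
  have h' := h.comp_injective
    (i := fun (l : Fin q → Fin n → ℤ) (i : Fin q × Fin n) => l i.1 i.2)
    (fun l l' hl => by ext i j; exact congrFun hl (i, j))
  refine Summable.of_norm_bounded_eventually h' ?_
  filter_upwards [(Set.finite_singleton (0 : Fin q → Fin n → ℤ)).compl_mem_cofinite] with l hl
  simp only [Function.comp_apply]
  set x : Fin q × Fin n → ℝ := fun i => (l i.1 i.2 : ℝ) with hx
  have hle : ‖x‖ ≤ 1 + ‖l‖ := by
    refine (pi_norm_le_iff_of_nonneg (by positivity)).2 fun i => ?_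
    have h1 := (norm_le_pi_norm (l i.1) i.2).trans (norm_le_pi_norm l i.1)
    have h2 : ‖x i‖ = ‖l i.1 i.2‖ := (Int.norm_eq_abs _).symm
    rw [h2]; linarith
  have hpos : 0 < ‖x‖ := norm_pos_iff.2 fun h0 => hl <| by
    ext i j
    have : ((l i j : ℤ) : ℝ) = 0 := congrFun h0 (i, j)
    exact_mod_cast this
  rw [Real.norm_of_nonneg (by positivity), Real.rpow_neg hpos.le, Real.rpow_natCast]
  exact inv_anti₀ (by positivity) (pow_le_pow_left₀ hpos.le hle _)

lemma IsSchwartz.summable_norm_mul_pow {q n : ℕ} {c : (Fin q → Fin n → ℤ) → ℂ}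
    (hc : IsSchwartz c) (M : ℕ) : Summable fun l => ‖c l‖ * (1 + ‖l‖) ^ M := by
  obtain ⟨N, hN⟩ := exists_summable_one_add_norm_pow_inv q n
  obtain ⟨C, hC⟩ := hc (M + N)
  refine (hN.mul_left C).of_nonneg_of_le (fun l => by positivity) fun l => ?_
  rw [← div_eq_mul_inv, le_div_iff₀ (by positivity)]
  refine le_of_eq_of_le ?_ (hC l)
  ring

lemma four_mul_abs_sub_round_le (t : ℝ) :
    4 * |t - round t| ≤ ‖Complex.exp (2 * Real.pi * Complex.I * (t : ℂ)) - 1‖ := by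
  have e : 2 * (Real.pi : ℂ) * Complex.I * (t : ℂ) = Complex.I * ((2 * Real.pi * t : ℝ) : ℂ) := by
    push_cast; ring
  rw [e, Complex.norm_exp_I_mul_ofReal_sub_one, norm_mul, Real.norm_ofNat, Real.norm_eq_abs]
  have h1 : |Real.sin (2 * Real.pi * t / 2)| = |Real.sin (Real.pi * (t - round t))| := by
    rw [show Real.pi * (t - round t) = 2 * Real.pi * t / 2 - round t * Real.pi by ring,
      Real.sin_sub_int_mul_pi, abs_mul, abs_zpow, abs_neg, abs_one, one_zpow, one_mul]
  have h2 : |Real.pi * (t - round t)| ≤ Real.pi / 2 := by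
    rw [abs_mul, abs_of_pos Real.pi_pos]
    have := abs_sub_round t
    nlinarith [Real.pi_pos]
  have h3 := Real.mul_abs_le_abs_sin h2
  rw [abs_mul, abs_of_pos Real.pi_pos, ← mul_assoc, div_mul_cancel₀ _ Real.pi_ne_zero] at h3
  rw [h1]
  linarith

lemma pair_neg_apply {n : ℕ} (Θ : Matrix (Fin n) (Fin n) ℝ) (u m : Fin n → ℤ) :
    pair (-u) (apply Θ m) = -pair m (Θ.transpose.mulVec fun i => (u i : ℝ)) := by
  have h : pair u (apply Θ m) = pair m (Θ.transpose.mulVec fun i => (u i : ℝ)) := by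
    change (fun i => (u i : ℝ)) ⬝ᵥ (Θ.mulVec fun i => (m i : ℝ)) =
      (fun i => (m i : ℝ)) ⬝ᵥ (Θ.transpose.mulVec fun i => (u i : ℝ))
    rw [Matrix.dotProduct_mulVec, Matrix.mulVec_transpose, dotProduct_comm]
  rw [← h]
  simp [pair]

/-- The small divisors of a badly approximable matrix. -/
lemma chr_apply_bound {n : ℕ} {Θ : Matrix (Fin n) (Fin n) ℝ} {u : Fin n → ℤ} {δ c₀ : ℝ}
    (hc : 0 < c₀) (hΘ : ∀ k : Fin n → ℤ, k ≠ 0 → ∀ m : ℤ, c₀ * euclNorm k ^ (-δ) ≤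
      |pair k (Θ.transpose.mulVec fun i => (u i : ℝ)) - m|) {m : Fin n → ℤ} (hm : m ≠ 0) :
    chr (apply Θ m) (-u) ≠ 1 ∧
      ‖(chr (apply Θ m) (-u) - 1)⁻¹‖ ≤ (4 * c₀)⁻¹ * euclNorm m ^ δ := by
  have h0 : 0 < euclNorm m := by
    rw [← norm_intVec]; exact zero_lt_one.trans_le (one_le_norm_intVec hm)
  set t : ℝ := pair (-u) (apply Θ m) with ht
  have h1 : c₀ * euclNorm m ^ (-δ) ≤ |t - round t| := by
    have := hΘ m hm (-round t)
    rw [ht, pair_neg_apply] at *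
    rw [← abs_neg]
    convert this using 2
    push_cast; ring
  have h2 : 4 * (c₀ * euclNorm m ^ (-δ)) ≤ ‖chr (apply Θ m) (-u) - 1‖ :=
    (mul_le_mul_of_nonneg_left h1 (by norm_num)).trans (four_mul_abs_sub_round_le t)
  have h3 : 0 < 4 * (c₀ * euclNorm m ^ (-δ)) := by positivity
  refine ⟨fun h => ?_, ?_⟩
  · rw [h, sub_self, norm_zero] at h2
    linarith
  · rw [norm_inv]
    refine (inv_anti₀ h3 h2).trans (le_of_eq ?_)
    rw [Real.rpow_neg h0.le]
    field_simp

lemma euclNorm_combo_le {q n : ℕ} {ε : Fin q → ℤ} (hε : ∀ i, ε i = 1 ∨ ε i = 0 ∨ ε i = -1)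
    (l : Fin q → Fin n → ℤ) : euclNorm (combo ε l) ≤ (1 + n * q) * (1 + ‖l‖) := by
  have h1 : ∀ j, |((combo ε l j : ℤ) : ℝ)| ≤ q * ‖l‖ := fun j => by
    have e : ((combo ε l j : ℤ) : ℝ) = ∑ i, (ε i : ℝ) * (l i j : ℝ) := by
      simp [combo, Finset.sum_apply]
    rw [e]
    calc |∑ i, (ε i : ℝ) * (l i j : ℝ)| ≤ ∑ i, |(ε i : ℝ) * (l i j : ℝ)| := abs_sum_le_sum_abs _ _
      _ ≤ ∑ _i : Fin q, ‖l‖ := sum_le_sum fun i _ => by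
          rw [abs_mul]
          refine (mul_le_of_le_one_left (abs_nonneg _) ?_).trans ?_
          · rcases hε i with h | h | h <;> simp [h]
          · rw [← Int.norm_eq_abs]
            exact (norm_le_pi_norm (l i) j).trans (norm_le_pi_norm l i)
      _ = _ := by simp
  have h2 : euclNorm (combo ε l) ≤ ∑ j, |((combo ε l j : ℤ) : ℝ)| := by
    rw [euclNorm]
    refine Real.sqrt_le_iff.2 ⟨sum_nonneg fun _ _ => abs_nonneg _, ?_⟩
    simp only [← sq_abs ((combo ε l _ : ℤ) : ℝ)]
    exact sum_sq_le_sq_sum_of_nonneg fun _ _ => abs_nonneg _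
  have h3 : ∑ j, |((combo ε l j : ℤ) : ℝ)| ≤ n * (q * ‖l‖) := by
    refine (sum_le_sum fun j _ => h1 j).trans (le_of_eq ?_)
    simp
  have := norm_nonneg l
  have : (0 : ℝ) ≤ n * q := by positivity
  nlinarith

/-- The weights `(1 + |exp(2π i u·a) - 1|⁻¹)^N` at `a = Θ m` grow polynomially. -/
lemma exists_weight_bound {q n : ℕ} {Θ : Matrix (Fin n) (Fin n) ℝ} {u : Fin n → ℤ} {δ c₀ : ℝ}
    (hδ : 0 < δ) (hc : 0 < c₀) (hΘ : ∀ k : Fin n → ℤ, k ≠ 0 → ∀ m : ℤ,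
      c₀ * euclNorm k ^ (-δ) ≤ |pair k (Θ.transpose.mulVec fun i => (u i : ℝ)) - m|)
    {ε : Fin q → ℤ} (hε : ∀ i, ε i = 1 ∨ ε i = 0 ∨ ε i = -1) (N : ℕ) :
    ∃ (A : ℝ) (M : ℕ), 0 ≤ A ∧ ∀ l : Fin q → Fin n → ℤ, combo ε l ≠ 0 →
      (1 + ‖(chr (apply Θ (combo ε l)) (-u) - 1)⁻¹‖) ^ N ≤ A * (1 + ‖l‖) ^ M := by
  set D : ℕ := ⌈δ⌉₊
  set B : ℝ := 1 + n * q
  have hB : 1 ≤ B := by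
    have : (0 : ℝ) ≤ n * q := by positivity
    linarith
  refine ⟨(1 + (4 * c₀)⁻¹ * B ^ D) ^ N, D * N, by positivity, fun l hl => ?_⟩
  rw [pow_mul, ← mul_pow]
  refine pow_le_pow_left₀ (by positivity) ?_ N
  have hX : 1 ≤ 1 + ‖l‖ := by linarith [norm_nonneg l]
  have h1 := (chr_apply_bound hc hΘ hl).2
  have h0 : 0 ≤ euclNorm (combo ε l) := Real.sqrt_nonneg _
  have h2 : euclNorm (combo ε l) ^ δ ≤ B ^ D * (1 + ‖l‖) ^ D := by
    rw [← mul_pow, ← Real.rpow_natCast]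
    refine (Real.rpow_le_rpow h0 (euclNorm_combo_le hε l) hδ.le).trans ?_
    exact Real.rpow_le_rpow_of_exponent_le (one_le_mul_of_one_le_of_one_le hB hX)
      (Nat.le_ceil δ)
  have h3 : (4 * c₀)⁻¹ * euclNorm (combo ε l) ^ δ ≤ (4 * c₀)⁻¹ * (B ^ D * (1 + ‖l‖) ^ D) :=
    mul_le_mul_of_nonneg_left h2 (by positivity)
  have h4 : 1 ≤ (1 + ‖l‖) ^ D := one_le_pow₀ hX
  nlinarith

/-- The resonance-free part of `g` extends to an entire function. -/
lemma hasEntireExtension_tsum {n p q : ℕ} {P : MvPolynomial (Fin n) ℂ}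
    (hP : P.IsHomogeneous p) {Θ : Matrix (Fin n) (Fin n) ℝ} (hΘ : BadlyApproximableMatrix Θ)
    {ε : Fin q → ℤ} (hε : ∀ i, ε i = 1 ∨ ε i = 0 ∨ ε i = -1) {c : (Fin q → Fin n → ℤ) → ℂ}
    (hc : IsSchwartz c) (hc0 : ∀ l, combo ε l = 0 → c l = 0) :
    HasEntireExtension (n + p : ℝ)
      fun s => ∑' l, c l * lattSum (gen P 0) (apply Θ (combo ε l)) s := by
  obtain ⟨u, δ, hδ, c₀, hc₀, hbad⟩ := hΘ
  have hs := symb_gen_zero hP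
  refine hasEntireExtension_of_forall ?_ fun N => ?_
  · have h := (tsum_unifAnalytic (lattSum_unifAnalytic hs) (fun l => apply Θ (combo ε l)) c
      (by simpa using hc.summable_norm_mul_pow 0)).1
    simpa using h
  · obtain ⟨E, hE, hagree⟩ := exists_unifAnalytic_lattSum u N hs
    obtain ⟨A, M, hA, hW⟩ := exists_weight_bound hδ hc₀ hbad hε N
    have hsum : Summable fun l =>
        ‖c l‖ * (1 + ‖(chr (apply Θ (combo ε l)) (-u) - 1)⁻¹‖) ^ N := by
      refine ((hc.summable_norm_mul_pow M).mul_left A).of_nonneg_of_le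
        (fun l => by positivity) fun l => ?_
      by_cases hl : combo ε l = 0
      · rw [hc0 l hl]; simp
      · calc _ ≤ ‖c l‖ * (A * (1 + ‖l‖) ^ M) :=
              mul_le_mul_of_nonneg_left (hW l hl) (norm_nonneg _)
          _ = _ := by ring
    refine ⟨_, by simpa using (tsum_unifAnalytic hE (fun l => apply Θ (combo ε l)) c hsum).1,
      n + p, fun s hs => tsum_congr fun l => ?_⟩
    by_cases hl : combo ε l = 0
    · simp [hc0 l hl]
    · rw [hagree _ (chr_apply_bound hc₀ hbad hl).1 s (by simpa using hs)]

lemma summable_mul_f {n p q : ℕ} {P : MvPolynomial (Fin n) ℂ} (hP : P.IsHomogeneous p)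
    (Θ : Matrix (Fin n) (Fin n) ℝ) (ε : Fin q → ℤ) {c : (Fin q → Fin n → ℤ) → ℂ}
    (hc : IsSchwartz c) {s : ℂ} (hs : (n + p : ℝ) < s.re) :
    Summable fun l => c l * f P (apply Θ (combo ε l)) s := by
  have h := (tsum_unifAnalytic (lattSum_unifAnalytic (symb_gen_zero hP))
    (fun l => apply Θ (combo ε l)) c (by simpa using hc.summable_norm_mul_pow 0)).2 s
    (by simpa using hs)
  simpa only [f_eq_lattSum] using h

lemma IsSchwartz.summable {q n : ℕ} {c : (Fin q → Fin n → ℤ) → ℂ} (hc : IsSchwartz c) :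
    Summable c :=
  Summable.of_norm (by simpa using hc.summable_norm_mul_pow 0)

/-- Splitting off the resonant terms of `g`. -/
lemma g_eq_add {n p q : ℕ} {P : MvPolynomial (Fin n) ℂ} (hP : P.IsHomogeneous p)
    (Θ : Matrix (Fin n) (Fin n) ℝ) (ε : Fin q → ℤ) {c : (Fin q → Fin n → ℤ) → ℂ}
    (hc : IsSchwartz c) {s : ℂ} (hs : (n + p : ℝ) < s.re) :
    g P Θ ε c s = (∑' l : {l : Fin q → Fin n → ℤ // combo ε l = 0}, c l.1) *
      lattSum (gen P 0) 0 s + ∑' l, (if combo ε l = 0 then 0 else c l) *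
        lattSum (gen P 0) (apply Θ (combo ε l)) s := by
  have h1 := summable_mul_f hP Θ ε hc hs
  simp only [f_eq_lattSum] at h1
  have hres := h1.indicator {l | combo ε l = 0}
  have hnon := h1.indicator {l | combo ε l = 0}ᶜ
  have hsub : (∑' l : {l : Fin q → Fin n → ℤ // combo ε l = 0}, c l.1) *
      lattSum (gen P 0) 0 s = ∑' l, Set.indicator {l | combo ε l = 0}
        (fun l => c l * lattSum (gen P 0) (apply Θ (combo ε l)) s) l := by
    rw [← tsum_mul_right, ← _root_.tsum_subtype]
    refine tsum_congr fun l => ?_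
    have : apply Θ (combo ε l.1) = 0 := by
      rw [show combo ε l.1 = 0 from l.2]
      ext i; simp [apply, Matrix.mulVec, dotProduct]
    rw [this]
  rw [hsub, g]
  simp only [f_eq_lattSum]
  have hsub' : (∑' l, (if combo ε l = 0 then 0 else c l) *
      lattSum (gen P 0) (apply Θ (combo ε l)) s) = ∑' l, Set.indicator {l | combo ε l = 0}ᶜ
        (fun l => c l * lattSum (gen P 0) (apply Θ (combo ε l)) s) l :=
    tsum_congr fun l => by
      by_cases hl : combo ε l = 0 <;> simp [hl]
  rw [hsub', ← hres.tsum_add hnon]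
  exact tsum_congr fun l => by by_cases hl : combo ε l = 0 <;> simp [hl]

lemma neg_one_le_meromorphicOrderAt {K : ℂ → ℂ} (hK : Differentiable ℂ K) (c : ℂ) :
    ((-1 : ℤ) : WithTop ℤ) ≤ meromorphicOrderAt (fun z => (z - c)⁻¹ * K z) c := by
  have h1 : meromorphicOrderAt (fun z : ℂ => (z - c)⁻¹) c = ((-1 : ℤ) : WithTop ℤ) := by
    rw [meromorphicOrderAt_eq_int_iff (by fun_prop)]
    exact ⟨fun _ => 1, analyticAt_const, one_ne_zero, Eventually.of_forall fun z => by simp⟩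
  have h2 := (hK.analyticAt c).meromorphicOrderAt_nonneg
  have h3 := meromorphicOrderAt_mul (x := c) (f := fun z : ℂ => (z - c)⁻¹) (g := K)
    (by fun_prop) (hK.analyticAt c).meromorphicAt
  have h4 : ((-1 : ℤ) : WithTop ℤ) ≤ ((-1 : ℤ) : WithTop ℤ) + meromorphicOrderAt K c :=
    le_add_of_nonneg_right h2
  rw [← h1, ← h3, h1] at h4
  exact h4

lemma meromorphic_inv_sub_mul {K : ℂ → ℂ} (hK : Differentiable ℂ K) (c : ℂ) :
    Meromorphic fun z => (z - c)⁻¹ * K z := fun z => by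
  have h1 : MeromorphicAt K z := (hK.analyticAt z).meromorphicAt
  fun_prop

end

end EpsteinZeta

end

theorem mainTheorem3 (n : ℕ) (hn : 1 ≤ n) (p : ℕ) (P : MvPolynomial (Fin n) ℂ)
    (hP : P.IsHomogeneous p) :
    -- the series converge absolutely for `Re s > n + p`
    (∀ (a : Fin n → ℝ) (s : ℂ), (n + p : ℝ) < s.re →
      Summable (fun k : {k : Fin n → ℤ // k ≠ 0} => EpsteinZeta.term P a s k.1)) ∧
    -- (i)
    (∀ a : Fin n → ℝ, EpsteinZeta.IsIntegerVector a →
      (∃ F : ℂ → ℂ, Meromorphic F ∧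
        EpsteinZeta.AgreeOnHalfPlane (n + p : ℝ) (EpsteinZeta.f P a) F ∧
        EpsteinZeta.HasResidueAt F (n + p : ℂ) (EpsteinZeta.sphereIntegral P)) ∧
      (¬ EpsteinZeta.HasEntireExtension (n + p : ℝ) (EpsteinZeta.f P a) ↔
        EpsteinZeta.sphereIntegral P ≠ 0)) ∧
    -- (ii)
    (∀ a : Fin n → ℝ, ¬ EpsteinZeta.IsIntegerVector a →
      EpsteinZeta.HasEntireExtension (n + p : ℝ) (EpsteinZeta.f P a)) ∧
    -- (iii)
    (∀ Θ : Matrix (Fin n) (Fin n) ℝ, EpsteinZeta.BadlyApproximableMatrix Θ →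
      ∀ q : ℕ, 0 < q → ∀ ε : Fin q → ℤ, (∀ i, ε i = 1 ∨ ε i = 0 ∨ ε i = -1) →
      ∀ c : (Fin q → Fin n → ℤ) → ℂ, EpsteinZeta.IsSchwartz c →
        Summable c ∧
        (∀ s : ℂ, (n + p : ℝ) < s.re →
          Summable (fun l : Fin q → Fin n → ℤ =>
            c l * EpsteinZeta.f P (EpsteinZeta.apply Θ (EpsteinZeta.combo ε l)) s)) ∧
        ∃ G : ℂ → ℂ, Meromorphic G ∧
          EpsteinZeta.AgreeOnHalfPlane (n + p : ℝ) (EpsteinZeta.g P Θ ε c) G ∧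
          (∀ z : ℂ, z ≠ (n + p : ℂ) → AnalyticAt ℂ G z) ∧
          ((-1 : ℤ) : WithTop ℤ) ≤ meromorphicOrderAt G (n + p : ℂ) ∧
          EpsteinZeta.HasResidueAt G (n + p : ℂ)
            ((∑' l : {l : Fin q → Fin n → ℤ // EpsteinZeta.combo ε l = 0}, c l.1) *
              EpsteinZeta.sphereIntegral P)) := by 
  open EpsteinZeta in
  refine ⟨fun a s hs => summable_term hP a hs, fun a ha => ?_, fun a ha =>
    hasEntireExtension_of_not_isIntegerVector hP ha, fun Θ hΘ q _ ε hε c hc =>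
    ⟨hc.summable, fun s hs => summable_mul_f hP Θ ε hc hs, ?_⟩⟩
  · rw [show f P a = lattSum (gen P 0) 0 from funext fun s => f_of_isIntegerVector P ha s]
    obtain ⟨E, hE, hval, hagree⟩ := exists_entire_div hn hP
    exact ⟨⟨_, meromorphic_inv_sub_mul hE (n + p), fun s hs => hagree s hs,
      hval ▸ hasResidueAt_div hE (n + p)⟩, not_hasEntireExtension_iff hn hP⟩
  · obtain ⟨E, hE, hval, hagree⟩ := exists_entire_div hn hP
    have hc' : IsSchwartz fun l => if combo ε l = 0 then 0 else c l := fun N => by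
      obtain ⟨C, hC⟩ := hc N
      refine ⟨C, fun l => le_trans ?_ (hC l)⟩
      refine mul_le_mul_of_nonneg_left ?_ (by positivity)
      beta_reduce
      split_ifs <;> simp
    obtain ⟨H, hH, hHagree⟩ := hasEntireExtension_tsum hP hΘ hε hc' fun l hl => if_pos hl
    set ζ : ℂ := ∑' l : {l : Fin q → Fin n → ℤ // combo ε l = 0}, c l.1
    set K : ℂ → ℂ := fun s => ζ * E s + (s - (n + p)) * H s with hKdef
    have hK : Differentiable ℂ K := by fun_prop
    have hKval : K (n + p) = ζ * sphereIntegral P := by simp [hKdef, hval]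
    refine ⟨_, meromorphic_inv_sub_mul hK (n + p), fun s hs => ?_, fun z hz => ?_,
      neg_one_le_meromorphicOrderAt hK _, hKval ▸ hasResidueAt_div hK (n + p)⟩
    · have hne : s - (n + p) ≠ 0 := fun h => by
        rw [sub_eq_zero.1 h] at hs
        simp at hs
      have hHs := hHagree s hs
      beta_reduce at hHs
      rw [g_eq_add hP Θ ε hc hs, ← hagree s hs, ← hHs]
      change (s - (n + p))⁻¹ * (ζ * E s + (s - (n + p)) * H s) = ζ * ((s - (n + p))⁻¹ * E s) + H s
      field_simp
    · exact ((analyticAt_id.sub analyticAt_const).inv (sub_ne_zero.2 hz)).mul (hK.analyticAt z)
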